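/- Let $(X,\mu)$ be a $\sigma$-finite measure space and let $A$ be a non-negative self-adjoint operator on $L^2(X)$ (real or complex valued functions) with spectral resolution $E_A$; for a real Borel function $\phi$ write $\phi(A)=\int_{\sigma(A)}\phi(\lambda)\,dE_A(\lambda)$, with domain $\{f\in L^2(X):\int|\phi|^2\,d\|E_A(\lambda)f\|_{L^2}^2<\infty\}$. Assume that for some $\alpha>0$ $$\|e^{-tA}\|_{L^2\to L^\infty}\lesssim t^{-\alpha},\qquad t>0 .$$ For $r\ge 0$ let $H^r(A)$ be the domain of $(I+A)^{r/2}$ with the norm $\|f\|_{H^r(A)}=\|(I+A)^{r/2}f\|_{L^2}$, and let $H^{-r}(A)$ be the dual space of $H^r(A)$; for $r>0$, a function $f\in L^q(X)$, $1\le q\le 2$, belongs to $H^{-r}(A)$ if $g\mapsto\int_X f\bar g\,d\mu$, $g\in H^r(A)\cap L^\infty(X)$, extends to a bounded conjugate-linear functional on $H^r(A)$ (the extension is unique), and $\|f\|_{H^{-r}(A)}$ is the norm of that functional; the operators $\phi(A)$ act on $H^{-r}(A)$ by duality. Put $\langle t\rangle=(1+t^2)^{1/2}$ and $\mathcal D(t,A)=\int_{\sigma(A)}\mathcal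 D(t,\lambda)\,dE_A(\lambda)$ with $$\mathcal D(t,\lambda)=\begin{cases}\dfrac{e^{-t/2}\sinh\big(t\sqrt{1/4-\lambda}\big)}{\sqrt{1/4-\lambda}}&(0\le\lambda<\tfrac14),\\[2mm] t\,e^{-t/2}&(\lambda=\tfrac14),\\[1mm] \dfrac{e^{-t/2}\sin\big(t\sqrt{\lambda-1/4}\big)}{\sqrt{\lambda-1/4}}&(\lambda>\tfrac14).\end{cases}$$ Let $k\in\{0,1\}$, $q\in[1,2]$, $s\ge 0$ and $\beta>2\alpha+k+s-1$. Then the following estimates hold, with constants independent of $f$ and $t$; in them $A^{s/2}\mathcal D(t,A)f$ and $A^{s/2}(\mathcal D(t,A)-e^{-tA})f$ are well defined in $L^2(X)$ for all $t>0$, and the time derivative $\partial_t^k$ exists in $L^2(X)$. (i) For all $t>0$, $$\|\partial_t^kA^{\frac s2}\mathcal D(t,A)f\|_{L^\infty}\lesssim\langle t\rangle^{-\frac{2\alpha}{q}-k-\frac s2}\big(\|f\|_{L^q}+e^{-\frac t4}\|f\|_{H^\beta(A)}\big),\qquad f\in L^q(X)\cap H^\beta(A),$$ $$\|\partial_t^kA^{\frac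 s2}\mathcal D(t,A)f\|_{L^2}\lesssim\langle t\rangle^{-2\alpha(\frac1q-\frac12)-k-\frac s2}\big(\|f\|_{L^q}+e^{-\frac t4}\|f\|_{H^{k+s-1}(A)}\big),\qquad f\in L^q(X)\cap H^{k+s-1}(A).$$ (ii) For all $t\ge 1$, $$\|\partial_t^kA^{\frac s2}(\mathcal D(t,A)-e^{-tA})f\|_{L^\infty}\lesssim\langle t\rangle^{-\frac{2\alpha}{q}-k-\frac s2-1}\big(\|f\|_{L^q}+e^{-\frac t4}\|f\|_{H^\beta(A)}\big),\qquad f\in L^q(X)\cap H^\beta(A),$$ $$\|\partial_t^kA^{\frac s2}(\mathcal D(t,A)-e^{-tA})f\|_{L^2}\lesssim\langle t\rangle^{-2\alpha(\frac1q-\frac12)-k-\frac s2-1}\big(\|f\|_{L^q}+e^{-\frac t4}\|f\|_{H^{k+s-1}(A)}\big),\qquad f\in L^q(X)\cap H^{k+s-1}(A).$$ -/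

import Mathlib

open MeasureTheory Filter Topology
open scoped ENNReal InnerProductSpace

noncomputable section

section Spectral

variable {𝕜 H : Type*} [RCLike 𝕜] [NormedAddCommGroup H] [InnerProductSpace 𝕜 H] [CompleteSpace H]

variable (𝕜 H) in
/-- A resolution of the identity: a projection-valued measure on the Borel sets of `ℝ`, countably
additive in the strong operator topology. The projection `E_A(λ)` is `proj (Set.Iic λ)`. Values on
sets that are not Borel are irrelevant. -/
structure SpectralMeasure where
  proj : Set ℝ → H →L[𝕜] H
  isStarProjection : ∀ B, MeasurableSet B → IsStarProjection (proj B)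
  proj_univ : proj Set.univ = 1
  hasSum_iUnion : ∀ B : ℕ → Set ℝ, (∀ n, MeasurableSet (B n)) →
    Pairwise (Function.onFun Disjoint B) →
    ∀ f : H, HasSum (fun n => proj (B n) f) (proj (⋃ n, B n) f)

namespace SpectralMeasure

variable (E : SpectralMeasure 𝕜 H)

theorem proj_empty (f : H) : E.proj ∅ f = 0 := by
  have h := (E.hasSum_iUnion (fun _ => ∅) (fun _ => MeasurableSet.empty)
    (fun _ _ _ => disjoint_bot_left) f).summable
  exact (summable_const_iff _).1 h

theorem norm_sq_proj {B : Set ℝ} (hB : MeasurableSet B) (f : H) :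
    ‖E.proj B f‖ ^ 2 = RCLike.re (inner 𝕜 f (E.proj B f)) := by
  have hP := E.isStarProjection B hB
  have hs : ContinuousLinearMap.adjoint (E.proj B) = E.proj B := hP.isSelfAdjoint
  have hi : E.proj B (E.proj B f) = E.proj B f := by
    have := congrArg (fun T : H →L[𝕜] H => T f) hP.isIdempotentElem
    simpa using this
  rw [← inner_self_eq_norm_sq (𝕜 := 𝕜)]
  congr 1
  conv_lhs => rw [← ContinuousLinearMap.adjoint_inner_right, hs, hi]

/-- The finite Borel measure `d‖E(λ) f‖²`. -/
def scalarMeasure (f : H) : Measure ℝ :=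
  Measure.ofMeasurable (fun B _ => ENNReal.ofReal (‖E.proj B f‖ ^ 2))
    (by simp [E.proj_empty f])
    (by
      intro B hB hd
      have h := E.hasSum_iUnion B hB hd f
      have h2 : HasSum (fun n => ‖E.proj (B n) f‖ ^ 2) (‖E.proj (⋃ n, B n) f‖ ^ 2) := by
        simp_rw [E.norm_sq_proj (MeasurableSet.iUnion hB), fun n => E.norm_sq_proj (hB n) f]
        exact (h.mapL (innerSL 𝕜 f)).mapL RCLike.reCLM
      rw [← h2.tsum_eq, ENNReal.ofReal_tsum_of_nonneg (fun n => by positivity) h2.summable])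

theorem scalarMeasure_apply (f : H) {B : Set ℝ} (hB : MeasurableSet B) :
    E.scalarMeasure f B = ENNReal.ofReal (‖E.proj B f‖ ^ 2) :=
  Measure.ofMeasurable_apply B hB

theorem scalarMeasure_add_le (f g : H) :
    E.scalarMeasure (f + g) ≤ (2 : ℝ≥0∞) • (E.scalarMeasure f + E.scalarMeasure g) := by
  refine Measure.le_iff.2 fun B hB => ?_
  simp only [Measure.smul_apply, Measure.add_apply, smul_eq_mul, E.scalarMeasure_apply _ hB]
  rw [← ENNReal.ofReal_add (by positivity) (by positivity),
    show (2 : ℝ≥0∞) = ENNReal.ofReal 2 by simp, ← ENNReal.ofReal_mul (by norm_num)]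
  apply ENNReal.ofReal_le_ofReal
  rw [map_add]
  have := norm_add_le (E.proj B f) (E.proj B g)
  nlinarith [sq_nonneg (‖E.proj B f‖ - ‖E.proj B g‖), norm_nonneg (E.proj B f + E.proj B g)]

theorem scalarMeasure_smul (c : 𝕜) (f : H) :
    E.scalarMeasure (c • f) = ENNReal.ofReal (‖c‖ ^ 2) • E.scalarMeasure f := by
  refine Measure.ext fun B hB => ?_
  simp only [Measure.smul_apply, smul_eq_mul, E.scalarMeasure_apply _ hB]
  rw [map_smul, norm_smul, mul_pow, ENNReal.ofReal_mul (by positivity)]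

/-- `Dom(φ(A)) = {f : ∫ |φ(λ)|² d‖E(λ) f‖² < ∞}`. -/
def domain (φ : ℝ → ℝ) : Submodule 𝕜 H where
  carrier := {f | ∫⁻ x, ENNReal.ofReal (φ x ^ 2) ∂(E.scalarMeasure f) < ⊤}
  zero_mem' := by
    have : E.scalarMeasure (0 : H) = 0 := by
      refine Measure.ext fun B hB => ?_
      simp [E.scalarMeasure_apply _ hB]
    simp [this]
  add_mem' := by
    intro f g hf hg
    refine lt_of_le_of_lt (lintegral_mono' (E.scalarMeasure_add_le f g) le_rfl) ?_
    rw [lintegral_smul_measure, lintegral_add_measure]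
    exact ENNReal.mul_lt_top (by simp) (ENNReal.add_lt_top.2 ⟨hf, hg⟩)
  smul_mem' := by
    intro c f hf
    simp only [Set.mem_ofPred_eq, E.scalarMeasure_smul, lintegral_smul_measure]
    exact ENNReal.mul_lt_top ENNReal.ofReal_lt_top hf

/-- `∫ σ(λ) dE(λ) f` for a simple function `σ`. -/
def simpleIntegral (σ : SimpleFunc ℝ ℝ) (f : H) : H :=
  ∑ y ∈ σ.range, (y : 𝕜) • E.proj (σ ⁻¹' {y}) f

/-- `f ∈ Dom(φ(A))` and `φ(A) f = u`, where `φ(A) = ∫ φ(λ) dE(λ)` for a Borel function `φ`: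
`u` is the limit of `∫ σₙ(λ) dE(λ) f` for all simple functions `σₙ` that tend to `φ` in
`L²(d‖E(λ) f‖²)`. -/
def HasIntegral (φ : ℝ → ℝ) (f u : H) : Prop :=
  Measurable φ ∧ f ∈ E.domain φ ∧
    ∀ σ : ℕ → SimpleFunc ℝ ℝ,
      Tendsto (fun n => ∫⁻ x, ENNReal.ofReal ((σ n x - φ x) ^ 2) ∂(E.scalarMeasure f))
        atTop (𝓝 0) →
      Tendsto (fun n => E.simpleIntegral (σ n) f) atTop (𝓝 u)

/-- `E` is the spectral resolution of `A`: `A = ∫ λ dE(λ)`, with equality of domains. -/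
def IsResolutionOf (E : SpectralMeasure 𝕜 H) (A : H →ₗ.[𝕜] H) : Prop :=
  ∀ f u : H, (f, u) ∈ A.graph ↔ E.HasIntegral (fun x => x) f u

open Classical in
/-- The point mass at `0`, the spectral resolution of the zero operator. -/
instance : Nonempty (SpectralMeasure 𝕜 H) :=
  ⟨{ proj := fun B => if (0 : ℝ) ∈ B then 1 else 0
     isStarProjection := by
       intro B _
       split_ifs
       · exact IsStarProjection.one _
       · exact IsStarProjection.zero _
     proj_univ := by simp
     hasSum_iUnion := by
       intro B _ hd f
       by_cases h : ∃ n, (0 : ℝ) ∈ B n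
       · obtain ⟨n, hn⟩ := h
         have h0 : (0 : ℝ) ∈ ⋃ n, B n := Set.mem_iUnion.2 ⟨n, hn⟩
         rw [if_pos h0]
         convert hasSum_single n ?_ using 1
         · rw [if_pos hn]
         · intro m hm
           have : (0 : ℝ) ∉ B m := fun hm0 => Set.disjoint_left.1 (hd hm) hm0 hn
           rw [if_neg this]; rfl
       · have h0 : (0 : ℝ) ∉ ⋃ n, B n := by simpa using h
         rw [if_neg h0]
         have : ∀ n, (0 : ℝ) ∉ B n := by simpa using h
         simp only [this, if_false]
         exact hasSum_zero }⟩

end SpectralMeasure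

/-- The spectral resolution `E_A` of `A`: the (unique) projection-valued measure with
`A = ∫ λ dE_A(λ)` (arbitrary if there is none). -/
def spectralResolution (A : H →ₗ.[𝕜] H) : SpectralMeasure 𝕜 H :=
  Classical.epsilon fun E => E.IsResolutionOf A

/-- `f ∈ Dom(φ(A))` and `φ(A) f = u`. -/
def FuncCalc (A : H →ₗ.[𝕜] H) (φ : ℝ → ℝ) (f u : H) : Prop :=
  (spectralResolution A).HasIntegral φ f u

/-- The symbol of `(I + A)^{r/2}`. -/
def besselSymbol (r x : ℝ) : ℝ := (1 + x) ^ (r / 2)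

/-- The space `H^r(A) = Dom((I + A)^{r/2})`, for `r ≥ 0`. -/
def sobolevSpace (A : H →ₗ.[𝕜] H) (r : ℝ) : Submodule 𝕜 H :=
  (spectralResolution A).domain (besselSymbol r)

/-- `‖f‖_{H^r(A)} = ‖(I + A)^{r/2} f‖` for `r ≥ 0` (equal to `⊤` for `f` outside `H^r(A)`). -/
def sobolevNorm (A : H →ₗ.[𝕜] H) (r : ℝ) (f : H) : ℝ≥0∞ :=
  ⨅ (u : H) (_ : FuncCalc A (besselSymbol r) f u), ‖u‖ₑ

/-- The norm, in the dual `H^{-r}(A)` of `H^r(A)`, of a conjugate-linear functional on `H^r(A)`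
(equal to `⊤` if the functional is not bounded). -/
def dualNorm (A : H →ₗ.[𝕜] H) (r : ℝ) (F : sobolevSpace A r →ₗ⋆[𝕜] 𝕜) : ℝ≥0∞ :=
  ⨆ g : sobolevSpace A r, ‖F g‖ₑ / sobolevNorm A r (g : H)

end Spectral

section Functions

variable {X 𝕜 : Type*} [RCLike 𝕜] [MeasurableSpace X] {μ : Measure X}

/-- The function `f` on `X`, as a distribution, is the element `F` of `H^{-r}(A)`, `r > 0`:
`F` is bounded and acts on `H^r(A) ∩ L^∞(X)` by the integral pairing with `f`. -/
def IsDualElement (A : Lp 𝕜 2 μ →ₗ.[𝕜] Lp 𝕜 2 μ) (r : ℝ) (f : X → 𝕜)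
    (F : sobolevSpace A r →ₗ⋆[𝕜] 𝕜) : Prop :=
  dualNorm A r F < ⊤ ∧
    ∀ g : sobolevSpace A r, MemLp ((g : Lp 𝕜 2 μ) : X → 𝕜) ⊤ μ →
      F g = ∫ x, inner 𝕜 ((g : Lp 𝕜 2 μ) x) (f x) ∂μ

open Classical in
/-- `‖f‖_{H^γ(A)}` for a function `f` on `X` and an order `γ` of either sign; it is finite exactly
when `f` belongs to `H^γ(A)`. -/
def fnSobolevNorm (A : Lp 𝕜 2 μ →ₗ.[𝕜] Lp 𝕜 2 μ) (γ : ℝ) (f : X → 𝕜) : ℝ≥0∞ :=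
  if 0 ≤ γ then ⨅ h : MemLp f 2 μ, sobolevNorm A γ (h.toLp f)
  else ⨅ (F : sobolevSpace A (-γ) →ₗ⋆[𝕜] 𝕜) (_ : IsDualElement A (-γ) f F), dualNorm A (-γ) F

/-- `φ(A) f = u` in `L²(X)` for a function `f` in `H^γ(A)`. For `γ ≥ 0` this is the functional
calculus on `L²(X)`; for `γ < 0` it is its extension by duality to `H^γ(A)`, that is
`⟨φ(A) f, g⟩ = ⟨f, φ(A) g⟩` for `g ∈ L²(X)`, with the pairing of `H^γ(A)` and `H^{-γ}(A)` on the
right. -/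
def FnFuncCalc (A : Lp 𝕜 2 μ →ₗ.[𝕜] Lp 𝕜 2 μ) (γ : ℝ) (φ : ℝ → ℝ) (f : X → 𝕜)
    (u : Lp 𝕜 2 μ) : Prop :=
  (0 ≤ γ → ∃ h : MemLp f 2 μ, FuncCalc A φ (h.toLp f) u) ∧
  (γ < 0 → ∃ F : sobolevSpace A (-γ) →ₗ⋆[𝕜] 𝕜, IsDualElement A (-γ) f F ∧
    ∀ g : Lp 𝕜 2 μ, ∃ v : sobolevSpace A (-γ), FuncCalc A φ g (v : Lp 𝕜 2 μ) ∧
      inner 𝕜 g u = F v)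

/-- `‖e^{-tA}‖_{L² → L^∞} ≲ t^{-α}` for `t > 0`. -/
def HeatDecay (A : Lp 𝕜 2 μ →ₗ.[𝕜] Lp 𝕜 2 μ) (α : ℝ) : Prop :=
  ∃ C : ℝ, 0 < C ∧ ∀ t : ℝ, 0 < t → ∀ f u : Lp 𝕜 2 μ,
    FuncCalc A (fun x => Real.exp (-(t * x))) f u →
    eLpNorm u ⊤ μ ≤ ENNReal.ofReal (C * t ^ (-α)) * eLpNorm f 2 μ

end Functions

/-- The symbol `𝒟(t, λ)`. -/
def dampedSymbol (t x : ℝ) : ℝ :=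
  if x < 1 / 4 then
    Real.exp (-t / 2) * Real.sinh (t * Real.sqrt (1 / 4 - x)) / Real.sqrt (1 / 4 - x)
  else if x = 1 / 4 then t * Real.exp (-t / 2)
  else Real.exp (-t / 2) * Real.sin (t * Real.sqrt (x - 1 / 4)) / Real.sqrt (x - 1 / 4)

/-- The symbol of `A^{s/2} 𝒟(t, A)`. -/
def solutionSymbol (s t x : ℝ) : ℝ := x ^ (s / 2) * dampedSymbol t x

/-- The symbol of `A^{s/2} (𝒟(t, A) - e^{-tA})`. -/
def differenceSymbol (s t x : ℝ) : ℝ :=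
  x ^ (s / 2) * (dampedSymbol t x - Real.exp (-(t * x)))

/-- `⟨t⟩ = (1 + t²)^{1/2}`. -/
def japaneseBracket (t : ℝ) : ℝ := Real.sqrt (1 + t ^ 2)

section Estimate

variable {X 𝕜 : Type*} [RCLike 𝕜] [MeasurableSpace X] {μ : Measure X}

/-- For the family of operators `m(t, A)`, the estimate
`‖∂_t^k m(t, A) f‖_{L^p} ≤ C ⟨t⟩^{-ρ} (‖f‖_{L^q} + e^{-t/4} ‖f‖_{H^γ(A)})` holds with a constant `C`
independent of `f ∈ L^q(X) ∩ H^γ(A)` and `t ∈ T`. It includes that `m(t, A) f` is defined, as an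
element of `L²(X)`, for all `t > 0`, and that its time derivatives up to order `k` exist in
`L²(X)` at all `t ∈ T`. -/
def DecayEstimate (A : Lp 𝕜 2 μ →ₗ.[𝕜] Lp 𝕜 2 μ) (m : ℝ → ℝ → ℝ) (k : ℕ) (p q : ℝ≥0∞)
    (γ ρ : ℝ) (T : Set ℝ) : Prop :=
  ∃ C : ℝ, 0 < C ∧ ∀ f : X → 𝕜, MemLp f q μ → fnSobolevNorm A γ f < ⊤ →
    ∃ w : ℝ → Lp 𝕜 2 μ, (∀ t, 0 < t → FnFuncCalc A γ (m t) f (w t)) ∧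
      ∀ t ∈ T, (∀ j < k, DifferentiableAt ℝ (iteratedDeriv j w) t) ∧
        eLpNorm (iteratedDeriv k w t : Lp 𝕜 2 μ) p μ ≤
          ENNReal.ofReal (C * japaneseBracket t ^ (-ρ)) *
            (eLpNorm f q μ + ENNReal.ofReal (Real.exp (-t / 4)) * fnSobolevNorm A γ f)

end Estimate

end

/-!
The heat decay forces the spectral measure to live on `(0, ∞)`, and by duality and interpolation it
gives the smoothing of `e^{-tA}` from `L^q` to `L²` and to `L^∞`; this smoothing is inherited by
`φ(A)` for every symbol with `|φ(λ)| ≤ M e^{-tλ}`. A function `f` in `H^γ(A)`, with `γ` of either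
sign, is handled through the vector `h = (I + A)^{γ/2} f` of `L²`.

Below the frequency `21/100` the roots of `r² + r + λ = 0` are real and separated. The fast mode
decays exponentially and the slow one is `e^{-tp}` with `p = λ + p²`, which differs from `e^{-tλ}`
by one more power of `λ` than its size: this is the gain of `t⁻¹` in the asymptotic behaviour.
Above `21/100` the symbol `𝒟(t, λ)` decays at a rate larger than `1/4` but gains only
`(1 + λ)^{-1/2}`, so that this part of the solution is measured in Sobolev norms; for the `L^∞`
estimates, a dyadic decomposition of the spectrum gives the embedding `H^σ(A) ⊂ L^∞`, `σ > 2α`.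
-/

noncomputable section

section SpectralCalculus

variable {𝕜 H : Type*} [RCLike 𝕜] [NormedAddCommGroup H] [InnerProductSpace 𝕜 H] [CompleteSpace H]

namespace SpectralMeasure

variable (E : SpectralMeasure 𝕜 H)

open Classical in
/-- The vector measure `B ↦ E(B) f`, with the value `0` on sets that are not Borel. -/
def vectorMeasure (f : H) : VectorMeasure ℝ H where
  measureOf' B := if MeasurableSet B then E.proj B f else 0
  empty' := by simp [E.proj_empty]
  not_measurable' _ hB := if_neg hB
  m_iUnion' B hB hd := by
    simpa only [hB, MeasurableSet.iUnion hB, if_true] using E.hasSum_iUnion B hB hd f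

theorem vectorMeasure_apply (f : H) {B : Set ℝ} (hB : MeasurableSet B) :
    E.vectorMeasure f B = E.proj B f :=
  if_pos hB

theorem proj_union {B B' : Set ℝ} (hB : MeasurableSet B) (hB' : MeasurableSet B')
    (hd : Disjoint B B') : E.proj (B ∪ B') = E.proj B + E.proj B' := by
  ext f
  have h := (E.vectorMeasure f).of_union hd hB hB'
  rwa [E.vectorMeasure_apply f hB, E.vectorMeasure_apply f hB',
    E.vectorMeasure_apply f (hB.union hB')] at h

theorem inner_proj_left {B : Set ℝ} (hB : MeasurableSet B) (f g : H) :
    ⟪E.proj B f, g⟫_𝕜 = ⟪f, E.proj B g⟫_𝕜 := by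
  rw [← ContinuousLinearMap.adjoint_inner_right,
    (E.isStarProjection B hB).isSelfAdjoint.adjoint_eq]

theorem proj_mul_proj_of_disjoint {B B' : Set ℝ} (hB : MeasurableSet B) (hB' : MeasurableSet B')
    (hd : Disjoint B B') : E.proj B * E.proj B' = 0 := by
  have hP := (E.isStarProjection B hB).isIdempotentElem
  have hP' := (E.isStarProjection B' hB').isIdempotentElem
  have hsum := (E.isStarProjection _ (hB.union hB')).isIdempotentElem
  rw [E.proj_union hB hB' hd, hP.add_iff hP'] at hsum
  have : IsAddTorsionFree (H →L[𝕜] H) := .of_isTorsionFree 𝕜 _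
  exact hP.mul_eq_zero_of_anticommute hsum

theorem proj_mul_proj {B B' : Set ℝ} (hB : MeasurableSet B) (hB' : MeasurableSet B') :
    E.proj B * E.proj B' = E.proj (B ∩ B') := by
  have hI := hB.inter hB'
  have hsplit : E.proj B = E.proj (B ∩ B') + E.proj (B \ B') := by
    rw [← E.proj_union hI (hB.diff hB') Set.disjoint_sdiff_inter.symm, Set.inter_union_sdiff]
  have hsplit' : E.proj B' = E.proj (B ∩ B') + E.proj (B' \ B) := by
    rw [Set.inter_comm, ← E.proj_union (hB'.inter hB) (hB'.diff hB)
      Set.disjoint_sdiff_inter.symm, Set.inter_union_sdiff]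
  rw [hsplit', mul_add, E.proj_mul_proj_of_disjoint hB (hB'.diff hB) Set.disjoint_sdiff_right,
    hsplit, add_mul, (E.isStarProjection _ hI).isIdempotentElem.eq,
    E.proj_mul_proj_of_disjoint (hB.diff hB') hI
      (Set.disjoint_sdiff_inter), add_zero, add_zero]

theorem proj_proj {B B' : Set ℝ} (hB : MeasurableSet B) (hB' : MeasurableSet B') (f : H) :
    E.proj B (E.proj B' f) = E.proj (B ∩ B') f :=
  DFunLike.congr_fun (E.proj_mul_proj hB hB') f

theorem proj_preimage_finset {β : Type*} (ρ : SimpleFunc ℝ β) (s : Finset β) (f : H) :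
    E.proj (ρ ⁻¹' s) f = ∑ b ∈ s, E.proj (ρ ⁻¹' {b}) f := by
  classical
  induction s using Finset.induction_on with
  | empty => simp [E.proj_empty]
  | insert b s hb ih =>
    rw [Finset.sum_insert hb, Finset.coe_insert, Set.insert_eq, Set.preimage_union,
      E.proj_union (ρ.measurableSet_preimage _) (ρ.measurableSet_preimage _), add_apply, ih]
    exact Disjoint.preimage _ (by simpa using hb)

theorem proj_preimage_singleton_of_notMem {β : Type*} {ρ : SimpleFunc ℝ β} {b : β}
    (hb : b ∉ ρ.range) (f : H) : E.proj (ρ ⁻¹' {b}) f = 0 := by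
  rw [Set.preimage_singleton_eq_empty.2 (by simpa using hb), E.proj_empty]

theorem simpleIntegral_map_of_range_subset {β : Type*} (ρ : SimpleFunc ℝ β) (g : β → ℝ)
    {s : Finset β} (hs : ρ.range ⊆ s) (f : H) :
    E.simpleIntegral (ρ.map g) f = ∑ b ∈ s, (g b : 𝕜) • E.proj (ρ ⁻¹' {b}) f := by
  classical
  rw [← Finset.sum_subset hs fun b _ hb => by
      rw [E.proj_preimage_singleton_of_notMem hb, smul_zero],
    simpleIntegral, ← Finset.sum_fiberwise_of_maps_to (s := ρ.range) (t := (ρ.map g).range)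
      (g := g) fun b hb => by
        obtain ⟨x, rfl⟩ := SimpleFunc.mem_range.1 hb
        exact SimpleFunc.mem_range_self (ρ.map g) x]
  refine Finset.sum_congr rfl fun y _ => ?_
  rw [SimpleFunc.map_preimage_singleton, E.proj_preimage_finset, Finset.smul_sum]
  refine Finset.sum_congr (by congr) fun b hb => ?_
  rw [(Finset.mem_filter.1 hb).2]

theorem simpleIntegral_map {β : Type*} (ρ : SimpleFunc ℝ β) (g : β → ℝ) (f : H) :
    E.simpleIntegral (ρ.map g) f = ∑ b ∈ ρ.range, (g b : 𝕜) • E.proj (ρ ⁻¹' {b}) f :=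
  E.simpleIntegral_map_of_range_subset ρ g subset_rfl f

theorem simpleIntegral_sub (σ τ : SimpleFunc ℝ ℝ) (f : H) :
    E.simpleIntegral (σ - τ) f = E.simpleIntegral σ f - E.simpleIntegral τ f := by
  have hfst := E.simpleIntegral_map (σ.pair τ) Prod.fst f
  have hsnd := E.simpleIntegral_map (σ.pair τ) Prod.snd f
  have hsub := E.simpleIntegral_map (σ.pair τ) (fun p => p.1 - p.2) f
  change E.simpleIntegral σ f = _ at hfst
  change E.simpleIntegral τ f = _ at hsnd
  change E.simpleIntegral (σ - τ) f = _ at hsub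
  rw [hfst, hsnd, hsub, ← Finset.sum_sub_distrib]
  simp only [RCLike.ofReal_sub, sub_smul]

theorem simpleIntegral_mul (σ τ : SimpleFunc ℝ ℝ) (f : H) :
    E.simpleIntegral (σ * τ) f = E.simpleIntegral σ (E.simpleIntegral τ f) := by
  have hmul := E.simpleIntegral_map_of_range_subset (σ.pair τ) (fun p => p.1 * p.2)
    (s := σ.range ×ˢ τ.range) (fun p hp => by
      obtain ⟨x, rfl⟩ := SimpleFunc.mem_range.1 hp; simp) f
  change E.simpleIntegral (σ * τ) f = _ at hmul
  rw [hmul, Finset.sum_product]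
  simp only [simpleIntegral, map_sum, map_smul, Finset.smul_sum]
  refine Finset.sum_congr rfl fun y _ => Finset.sum_congr rfl fun z _ => ?_
  rw [E.proj_proj (σ.measurableSet_preimage _) (τ.measurableSet_preimage _), smul_smul,
    RCLike.ofReal_mul, SimpleFunc.pair_preimage_singleton]

theorem continuous_simpleIntegral (σ : SimpleFunc ℝ ℝ) : Continuous (E.simpleIntegral σ) := by
  unfold simpleIntegral
  fun_prop

theorem inner_simpleIntegral_left (σ : SimpleFunc ℝ ℝ) (f g : H) :
    ⟪E.simpleIntegral σ f, g⟫_𝕜 = ⟪f, E.simpleIntegral σ g⟫_𝕜 := by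
  simp only [simpleIntegral, sum_inner, inner_sum, inner_smul_left, inner_smul_right,
    RCLike.conj_ofReal, E.inner_proj_left (σ.measurableSet_preimage _)]

theorem norm_sq_simpleIntegral (σ : SimpleFunc ℝ ℝ) (f : H) :
    ‖E.simpleIntegral σ f‖ ^ 2 = ∑ y ∈ σ.range, y ^ 2 * ‖E.proj (σ ⁻¹' {y}) f‖ ^ 2 := by
  rw [← inner_self_eq_norm_sq (𝕜 := 𝕜), E.inner_simpleIntegral_left, ← E.simpleIntegral_mul,
    show σ * σ = σ.map (fun y => y * y) from rfl, E.simpleIntegral_map, inner_sum, map_sum]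
  refine Finset.sum_congr rfl fun y _ => ?_
  rw [inner_smul_right, RCLike.re_ofReal_mul, E.norm_sq_proj (σ.measurableSet_preimage _), sq]

theorem enorm_simpleIntegral (σ : SimpleFunc ℝ ℝ) (f : H) :
    ‖E.simpleIntegral σ f‖ₑ = eLpNorm σ 2 (E.scalarMeasure f) := by
  refine (ENNReal.pow_right_strictMono two_ne_zero).injective ?_
  have hlintegral : eLpNorm σ 2 (E.scalarMeasure f) ^ 2 =
      ∑ y ∈ σ.range, ‖y‖ₑ ^ 2 * E.scalarMeasure f (σ ⁻¹' {y}) := by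
    have h := eLpNorm_nnreal_pow_eq_lintegral (f := σ) (μ := E.scalarMeasure f)
      (p := 2) two_ne_zero
    simp only [NNReal.coe_ofNat, ENNReal.rpow_ofNat, ENNReal.coe_ofNat] at h
    rw [h, ← SimpleFunc.map_lintegral (fun y => ‖y‖ₑ ^ 2), ← SimpleFunc.lintegral_eq_lintegral]
    rfl
  rw [hlintegral, ← ofReal_norm, ← ENNReal.ofReal_pow (norm_nonneg _), E.norm_sq_simpleIntegral,
    ENNReal.ofReal_sum_of_nonneg fun y _ => by positivity]
  refine Finset.sum_congr rfl fun y _ => ?_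
  rw [E.scalarMeasure_apply _ (σ.measurableSet_preimage _), ENNReal.ofReal_mul (sq_nonneg y),
    ← ofReal_norm, ← ENNReal.ofReal_pow (norm_nonneg _), Real.norm_eq_abs, sq_abs]

theorem scalarMeasure_univ (f : H) : E.scalarMeasure f Set.univ = ‖f‖ₑ ^ 2 := by
  rw [E.scalarMeasure_apply _ MeasurableSet.univ, E.proj_univ, one_apply_eq_self,
    ENNReal.ofReal_pow (norm_nonneg _), ofReal_norm]

instance (f : H) : IsFiniteMeasure (E.scalarMeasure f) :=
  ⟨by rw [E.scalarMeasure_univ]; exact ENNReal.pow_lt_top enorm_lt_top⟩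

end SpectralMeasure

end SpectralCalculus

section LTwo

variable {α : Type*} [MeasurableSpace α]

theorem lintegral_ofReal_sq (ν : Measure α) (φ : α → ℝ) :
    ∫⁻ x, ENNReal.ofReal (φ x ^ 2) ∂ν = eLpNorm φ 2 ν ^ 2 := by
  have h := eLpNorm_nnreal_pow_eq_lintegral (f := φ) (μ := ν) (p := 2) two_ne_zero
  simp only [NNReal.coe_ofNat, ENNReal.rpow_ofNat, ENNReal.coe_ofNat] at h
  rw [h]
  refine lintegral_congr fun x => ?_
  rw [Real.enorm_eq_ofReal_abs, ← ENNReal.ofReal_pow (abs_nonneg _), sq_abs]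

theorem tendsto_sq_nhds_zero_iff {ι : Type*} {l : Filter ι} {a : ι → ℝ≥0∞} :
    Tendsto (fun i => a i ^ 2) l (𝓝 0) ↔ Tendsto a l (𝓝 0) := by
  refine ⟨fun h => ?_, fun h => by simpa using ENNReal.Tendsto.pow (n := 2) h⟩
  have hroot := h.ennrpow_const (1 / 2)
  rw [ENNReal.zero_rpow_of_pos one_half_pos] at hroot
  refine hroot.congr fun i => ?_
  rw [← ENNReal.rpow_natCast, ← ENNReal.rpow_mul, Nat.cast_ofNat, mul_one_div_cancel two_ne_zero,
    ENNReal.rpow_one]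

theorem exists_simpleFunc_tendsto_eLpNorm_sub {ν : Measure α} {φ : α → ℝ} (hm : Measurable φ)
    (hφ : MemLp φ 2 ν) :
    ∃ σ : ℕ → SimpleFunc α ℝ, Tendsto (fun n => eLpNorm (⇑(σ n) - φ) 2 ν) atTop (𝓝 0) :=
  ⟨_, SimpleFunc.tendsto_approxOn_range_Lp_eLpNorm (p := 2) ENNReal.ofNat_ne_top hm
    hφ.eLpNorm_lt_top⟩

end LTwo

section SpectralCalculus

variable {𝕜 H : Type*} [RCLike 𝕜] [NormedAddCommGroup H] [InnerProductSpace 𝕜 H] [CompleteSpace H]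

namespace SpectralMeasure

variable {E : SpectralMeasure 𝕜 H} {φ ψ : ℝ → ℝ} {f g u v : H}

theorem mem_domain_iff (hφ : Measurable φ) : f ∈ E.domain φ ↔ MemLp φ 2 (E.scalarMeasure f) := by
  change ∫⁻ x, ENNReal.ofReal (φ x ^ 2) ∂(E.scalarMeasure f) < ⊤ ↔ _
  rw [lintegral_ofReal_sq, ENNReal.pow_lt_top_iff, MemLp]
  simp [hφ.aestronglyMeasurable]

theorem hasIntegral_iff : E.HasIntegral φ f u ↔ Measurable φ ∧ MemLp φ 2 (E.scalarMeasure f) ∧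
    ∀ σ : ℕ → SimpleFunc ℝ ℝ,
      Tendsto (fun n => eLpNorm (⇑(σ n) - φ) 2 (E.scalarMeasure f)) atTop (𝓝 0) →
        Tendsto (fun n => E.simpleIntegral (σ n) f) atTop (𝓝 u) := by
  refine and_congr_right fun hφ => and_congr (mem_domain_iff hφ) (forall_congr' fun σ => ?_)
  have hsq (n : ℕ) : ∫⁻ x, ENNReal.ofReal ((σ n x - φ x) ^ 2) ∂(E.scalarMeasure f) =
      eLpNorm (⇑(σ n) - φ) 2 (E.scalarMeasure f) ^ 2 := lintegral_ofReal_sq _ (⇑(σ n) - φ)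
  simp only [hsq, tendsto_sq_nhds_zero_iff]

theorem HasIntegral.measurable (hu : E.HasIntegral φ f u) : Measurable φ := hu.1

theorem HasIntegral.memLp (hu : E.HasIntegral φ f u) : MemLp φ 2 (E.scalarMeasure f) :=
  (hasIntegral_iff.1 hu).2.1

theorem HasIntegral.tendsto (hu : E.HasIntegral φ f u) {σ : ℕ → SimpleFunc ℝ ℝ}
    (hσ : Tendsto (fun n => eLpNorm (⇑(σ n) - φ) 2 (E.scalarMeasure f)) atTop (𝓝 0)) :
    Tendsto (fun n => E.simpleIntegral (σ n) f) atTop (𝓝 u) :=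
  (hasIntegral_iff.1 hu).2.2 σ hσ

theorem HasIntegral.exists_simpleFunc (hu : E.HasIntegral φ f u) : ∃ σ : ℕ → SimpleFunc ℝ ℝ,
    Tendsto (fun n => eLpNorm (⇑(σ n) - φ) 2 (E.scalarMeasure f)) atTop (𝓝 0) ∧
      Tendsto (fun n => E.simpleIntegral (σ n) f) atTop (𝓝 u) :=
  let ⟨σ, hσ⟩ := exists_simpleFunc_tendsto_eLpNorm_sub hu.measurable hu.memLp
  ⟨σ, hσ, hu.tendsto hσ⟩

theorem edist_simpleIntegral_le (σ τ : SimpleFunc ℝ ℝ) (hφ : Measurable φ) (f : H) :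
    edist (E.simpleIntegral σ f) (E.simpleIntegral τ f) ≤
      eLpNorm (⇑σ - φ) 2 (E.scalarMeasure f) + eLpNorm (⇑τ - φ) 2 (E.scalarMeasure f) := by
  rw [edist_eq_enorm_sub, ← E.simpleIntegral_sub, E.enorm_simpleIntegral, SimpleFunc.coe_sub,
    ← sub_sub_sub_cancel_right (σ : ℝ → ℝ) τ φ]
  exact eLpNorm_sub_le (σ.measurable.sub hφ).aestronglyMeasurable
    (τ.measurable.sub hφ).aestronglyMeasurable one_le_two

theorem hasIntegral_of_tendsto (hm : Measurable φ) (hφ : MemLp φ 2 (E.scalarMeasure f))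
    {σ : ℕ → SimpleFunc ℝ ℝ}
    (hσ : Tendsto (fun n => eLpNorm (⇑(σ n) - φ) 2 (E.scalarMeasure f)) atTop (𝓝 0))
    (hu : Tendsto (fun n => E.simpleIntegral (σ n) f) atTop (𝓝 u)) : E.HasIntegral φ f u := by
  refine hasIntegral_iff.2 ⟨hm, hφ, fun τ hτ => tendsto_iff_edist_tendsto_0.2 ?_⟩
  have hlim : Tendsto (fun n => eLpNorm (⇑(τ n) - φ) 2 (E.scalarMeasure f) +
      eLpNorm (⇑(σ n) - φ) 2 (E.scalarMeasure f) + edist (E.simpleIntegral (σ n) f) u)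
      atTop (𝓝 0) := by
    simpa using (hτ.add hσ).add (tendsto_iff_edist_tendsto_0.1 hu)
  refine tendsto_nhds_bot_mono' hlim fun n =>
    (edist_triangle _ (E.simpleIntegral (σ n) f) _).trans ?_
  gcongr
  exact edist_simpleIntegral_le _ _ hm f

theorem exists_hasIntegral (hm : Measurable φ) (hφ : MemLp φ 2 (E.scalarMeasure f)) :
    ∃ u, E.HasIntegral φ f u := by
  obtain ⟨σ, hσ⟩ := exists_simpleFunc_tendsto_eLpNorm_sub hm hφ
  have hcauchy : CauchySeq fun n => E.simpleIntegral (σ n) f := by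
    refine EMetric.cauchySeq_iff.2 fun ε hε => ?_
    obtain ⟨N, hN⟩ := eventually_atTop.1 (hσ.eventually_lt_const (ENNReal.half_pos hε.ne'))
    refine ⟨N, fun m hm' n hn => (edist_simpleIntegral_le (σ m) (σ n) hm f).trans_lt ?_⟩
    exact (ENNReal.add_lt_add (hN m hm') (hN n hn)).trans_eq (ENNReal.add_halves ε)
  obtain ⟨u, hu⟩ := cauchySeq_tendsto_of_complete hcauchy
  exact ⟨u, hasIntegral_of_tendsto hm hφ hσ hu⟩

theorem exists_hasIntegral_of_ae_le {C : ℝ} (hm : Measurable φ)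
    (hC : ∀ᵐ x ∂(E.scalarMeasure f), |φ x| ≤ C) : ∃ u, E.HasIntegral φ f u :=
  exists_hasIntegral hm (.of_bound hm.aestronglyMeasurable C hC)

theorem HasIntegral.unique (hu : E.HasIntegral φ f u) (hv : E.HasIntegral φ f v) : u = v :=
  let ⟨_, hσ, hσu⟩ := hu.exists_simpleFunc
  tendsto_nhds_unique hσu (hv.tendsto hσ)

theorem HasIntegral.congr (hu : E.HasIntegral φ f u) (hm : Measurable ψ)
    (h : φ =ᵐ[E.scalarMeasure f] ψ) : E.HasIntegral ψ f u := by
  obtain ⟨σ, hσ, hσu⟩ := hu.exists_simpleFunc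
  refine hasIntegral_of_tendsto hm (hu.memLp.ae_eq h) (hσ.congr fun n => ?_) hσu
  exact eLpNorm_congr_ae (EventuallyEq.rfl.sub h)

theorem hasIntegral_simpleFunc (σ : SimpleFunc ℝ ℝ) (f : H) :
    E.HasIntegral σ f (E.simpleIntegral σ f) :=
  hasIntegral_of_tendsto σ.measurable (σ.memLp_of_isFiniteMeasure 2 _) (σ := fun _ => σ)
    (by simp) tendsto_const_nhds

theorem HasIntegral.sub (hu : E.HasIntegral φ f u) (hv : E.HasIntegral ψ f v) :
    E.HasIntegral (φ - ψ) f (u - v) := by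
  obtain ⟨σ, hσ, hσu⟩ := hu.exists_simpleFunc
  obtain ⟨τ, hτ, hτv⟩ := hv.exists_simpleFunc
  refine hasIntegral_of_tendsto (hu.measurable.sub hv.measurable) (hu.memLp.sub hv.memLp)
    (σ := fun n => σ n - τ n) ?_ (by simpa only [E.simpleIntegral_sub] using hσu.sub hτv)
  refine tendsto_nhds_bot_mono' (by simpa using hσ.add hτ) fun n => ?_
  rw [SimpleFunc.coe_sub, sub_sub_sub_comm]
  exact eLpNorm_sub_le ((σ n).measurable.sub hu.measurable).aestronglyMeasurable
    ((τ n).measurable.sub hv.measurable).aestronglyMeasurable one_le_two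

theorem HasIntegral.enorm_eq (hu : E.HasIntegral φ f u) :
    ‖u‖ₑ = eLpNorm φ 2 (E.scalarMeasure f) := by
  obtain ⟨σ, hσ, hσu⟩ := hu.exists_simpleFunc
  have hmem (n : ℕ) : MemLp (σ n) 2 (E.scalarMeasure f) := (σ n).memLp_of_isFiniteMeasure 2 _
  have hLp := ((Lp.tendsto_Lp_iff_tendsto_eLpNorm'' (fun n => ⇑(σ n)) hmem φ hu.memLp).2 hσ).enorm
  simp only [Lp.enorm_toLp, ← E.enorm_simpleIntegral] at hLp
  exact tendsto_nhds_unique hσu.enorm hLp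

theorem HasIntegral.enorm_le (hu : E.HasIntegral φ f u) (hv : E.HasIntegral ψ f v) {M : ℝ}
    (h : ∀ᵐ x ∂(E.scalarMeasure f), |φ x| ≤ M * |ψ x|) : ‖u‖ₑ ≤ ENNReal.ofReal M * ‖v‖ₑ := by
  rw [hu.enorm_eq, hv.enorm_eq]
  exact eLpNorm_le_mul_eLpNorm_of_ae_le_mul h 2

theorem HasIntegral.inner_left (hu : E.HasIntegral φ f u) (hv : E.HasIntegral φ g v) :
    ⟪u, g⟫_𝕜 = ⟪f, v⟫_𝕜 := by
  have hmem : MemLp φ 2 (E.scalarMeasure f + E.scalarMeasure g) :=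
    (memLp_two_iff_integrable_sq hu.measurable.aestronglyMeasurable).2
      (hu.memLp.integrable_sq.add_measure hv.memLp.integrable_sq)
  obtain ⟨σ, hσ⟩ := exists_simpleFunc_tendsto_eLpNorm_sub hu.measurable hmem
  have hσu := hu.tendsto <| tendsto_nhds_bot_mono' hσ fun n =>
    eLpNorm_mono_measure _ (Measure.le_add_right le_rfl)
  have hσv := hv.tendsto <| tendsto_nhds_bot_mono' hσ fun n =>
    eLpNorm_mono_measure _ (Measure.le_add_left le_rfl)
  have h := hσu.inner (𝕜 := 𝕜) (tendsto_const_nhds (x := g))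
  simp only [E.inner_simpleIntegral_left] at h
  exact tendsto_nhds_unique h (tendsto_const_nhds.inner hσv)

theorem HasIntegral.simpleFunc_mul (hu : E.HasIntegral φ f u) (τ : SimpleFunc ℝ ℝ) :
    E.HasIntegral (⇑τ * φ) f (E.simpleIntegral τ u) := by
  obtain ⟨σ, hσ, hσu⟩ := hu.exists_simpleFunc
  obtain ⟨C, hC⟩ := τ.exists_forall_norm_le
  have hmul (ρ : ℝ → ℝ) : eLpNorm (⇑τ * ρ) 2 (E.scalarMeasure f) ≤
      ENNReal.ofReal C * eLpNorm ρ 2 (E.scalarMeasure f) :=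
    eLpNorm_le_mul_eLpNorm_of_ae_le_mul (.of_forall fun x => by
      rw [Pi.mul_apply, norm_mul]; gcongr; exact hC x) 2
  refine hasIntegral_of_tendsto (τ.measurable.mul hu.measurable)
    ⟨(τ.measurable.mul hu.measurable).aestronglyMeasurable, (hmul φ).trans_lt
      (ENNReal.mul_lt_top ENNReal.ofReal_lt_top hu.memLp.eLpNorm_lt_top)⟩
    (σ := fun n => τ * σ n) ?_ ?_
  · have hlim : Tendsto (fun n => ENNReal.ofReal C * eLpNorm (⇑(σ n) - φ) 2 (E.scalarMeasure f))
        atTop (𝓝 0) := by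
      simpa using ENNReal.Tendsto.const_mul hσ (.inr ENNReal.ofReal_ne_top)
    refine tendsto_nhds_bot_mono' hlim fun n => ?_
    rw [SimpleFunc.coe_mul, ← mul_sub]
    exact hmul _
  · simpa only [E.simpleIntegral_mul, Function.comp_def] using
      ((E.continuous_simpleIntegral τ).tendsto u).comp hσu

theorem simpleIntegral_const (c : ℝ) (f : H) :
    E.simpleIntegral (.const ℝ c) f = (c : 𝕜) • f := by
  have h := E.simpleIntegral_map_of_range_subset (.const ℝ c) id (s := {c}) (by simp) f
  have hpre : SimpleFunc.const ℝ c ⁻¹' {c} = Set.univ := by ext; simp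
  rwa [Finset.sum_singleton, hpre, E.proj_univ] at h

theorem hasIntegral_one (f : H) : E.HasIntegral 1 f f := by
  have h := hasIntegral_simpleFunc (E := E) (.const ℝ 1) f
  rwa [simpleIntegral_const, RCLike.ofReal_one, one_smul] at h

theorem HasIntegral.const_mul (hu : E.HasIntegral φ f u) (c : ℝ) :
    E.HasIntegral (fun x => c * φ x) f ((c : 𝕜) • u) := by
  have h := hu.simpleFunc_mul (.const ℝ c)
  rwa [simpleIntegral_const] at h

theorem simpleIntegral_indicator_one {B : Set ℝ} (hB : MeasurableSet B) (f : H) :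
    E.simpleIntegral (.piecewise B hB (.const ℝ 1) (.const ℝ 0)) f = E.proj B f := by
  set χ : SimpleFunc ℝ ℝ := .piecewise B hB (.const ℝ 1) (.const ℝ 0)
  have hrange : χ.range ⊆ {1, 0} := fun y hy => by
    obtain ⟨x, rfl⟩ := SimpleFunc.mem_range.1 hy
    by_cases hx : x ∈ B <;> simp [χ, hx]
  have hpre : χ ⁻¹' {1} = B := by
    ext x
    by_cases hx : x ∈ B <;> simp [χ, hx]
  have h := E.simpleIntegral_map_of_range_subset χ id hrange f
  change E.simpleIntegral χ f = _ at h
  rw [h, Finset.sum_pair one_ne_zero, hpre]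
  simp

theorem HasIntegral.proj (hu : E.HasIntegral φ f u) {B : Set ℝ} (hB : MeasurableSet B) :
    E.HasIntegral (B.indicator φ) f (E.proj B u) := by
  have h := hu.simpleFunc_mul (.piecewise B hB (.const ℝ 1) (.const ℝ 0))
  rw [simpleIntegral_indicator_one] at h
  convert h using 1
  ext x
  by_cases hx : x ∈ B <;> simp [hx]

theorem HasIntegral.scalarMeasure_eq (hu : E.HasIntegral φ f u) :
    E.scalarMeasure u = (E.scalarMeasure f).withDensity fun x => ENNReal.ofReal (φ x ^ 2) := by
  refine Measure.ext fun B hB => ?_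
  rw [E.scalarMeasure_apply _ hB, withDensity_apply _ hB, ENNReal.ofReal_pow (norm_nonneg _),
    ofReal_norm, (hu.proj hB).enorm_eq, eLpNorm_indicator_eq_eLpNorm_restrict hB,
    lintegral_ofReal_sq]

theorem HasIntegral.eLpNorm_scalarMeasure (hu : E.HasIntegral φ f u) (hψ : Measurable ψ) :
    eLpNorm ψ 2 (E.scalarMeasure u) = eLpNorm (ψ * φ) 2 (E.scalarMeasure f) := by
  have hφ := hu.measurable
  refine (ENNReal.pow_right_strictMono two_ne_zero).injective ?_
  simp only [← lintegral_ofReal_sq]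
  rw [hu.scalarMeasure_eq, lintegral_withDensity_eq_lintegral_mul _ (by fun_prop) (by fun_prop)]
  refine lintegral_congr fun x => ?_
  rw [Pi.mul_apply, Pi.mul_apply, mul_pow, mul_comm, ENNReal.ofReal_mul (sq_nonneg _)]

theorem HasIntegral.comp (hu : E.HasIntegral φ f u) (hψ : Measurable ψ)
    (hv : E.HasIntegral (ψ * φ) f v) : E.HasIntegral ψ u v := by
  have hmem : MemLp ψ 2 (E.scalarMeasure u) := ⟨hψ.aestronglyMeasurable, by
    rw [hu.eLpNorm_scalarMeasure hψ]; exact hv.memLp.eLpNorm_lt_top⟩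
  obtain ⟨τ, hτ⟩ := exists_simpleFunc_tendsto_eLpNorm_sub hψ hmem
  refine hasIntegral_of_tendsto hψ hmem hτ (tendsto_iff_edist_tendsto_0.2 (hτ.congr fun n => ?_))
  rw [edist_eq_enorm_sub, ((hu.simpleFunc_mul (τ n)).sub hv).enorm_eq, ← sub_mul,
    hu.eLpNorm_scalarMeasure ((τ n).measurable.sub hψ)]

end SpectralMeasure

end SpectralCalculus

theorem norm_slope_le_of_norm_hasDerivWithinAt_le {F : Type*} [NormedAddCommGroup F]
    [NormedSpace ℝ F] {f f' : ℝ → F} {s : Set ℝ} {C a b : ℝ} (hs : Convex ℝ s)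
    (hf : ∀ t ∈ s, HasDerivWithinAt f (f' t) s t) (hC : ∀ t ∈ s, ‖f' t‖ ≤ C) (ha : a ∈ s)
    (hb : b ∈ s) : ‖slope f a b‖ ≤ C := by
  rw [slope_def_module, norm_smul, norm_inv]
  refine inv_mul_le_of_le_mul₀ (norm_nonneg _) ((norm_nonneg _).trans (hC a ha)) ?_
  rw [mul_comm]
  exact hs.norm_image_sub_le_of_norm_hasDerivWithin_le hf hC ha hb

section SpectralCalculus

variable {𝕜 H : Type*} [RCLike 𝕜] [NormedAddCommGroup H] [InnerProductSpace 𝕜 H] [CompleteSpace H]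

namespace SpectralMeasure

variable {E : SpectralMeasure 𝕜 H} {φ ψ : ℝ → ℝ} {f u v : H} {C : ℝ}

section Derivative

variable {Φ Φ' : ℝ → ℝ → ℝ} {w : ℝ → H} {t₀ δ : ℝ} {b : ℝ → ℝ}

theorem tendsto_eLpNorm_slope_sub (hδ : 0 < δ) (hb : MemLp b 2 (E.scalarMeasure f))
    (hm : ∀ t ∈ Metric.ball t₀ δ, Measurable (Φ t)) (hm' : Measurable (Φ' t₀))
    (hd : ∀ᵐ x ∂(E.scalarMeasure f), ∀ t ∈ Metric.ball t₀ δ,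
      HasDerivAt (Φ · x) (Φ' t x) t ∧ |Φ' t x| ≤ b x) :
    Tendsto (fun t => eLpNorm (fun x => slope (Φ · x) t₀ t - Φ' t₀ x) 2 (E.scalarMeasure f))
      (𝓝[≠] t₀) (𝓝 0) := by
  have ht₀ : t₀ ∈ Metric.ball t₀ δ := Metric.mem_ball_self hδ
  have hball : ∀ᶠ t in 𝓝[≠] t₀, t ∈ Metric.ball t₀ δ :=
    nhdsWithin_le_nhds (Metric.ball_mem_nhds _ hδ)
  rw [← tendsto_sq_nhds_zero_iff]
  simp only [← lintegral_ofReal_sq]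
  rw [← lintegral_zero (μ := E.scalarMeasure f)]
  refine tendsto_lintegral_filter_of_dominated_convergence
    (fun x => ENNReal.ofReal ((2 * b x) ^ 2)) ?_ ?_ ?_ ?_
  · filter_upwards [hball] with t ht
    have := hm t ht
    have := hm t₀ ht₀
    simp only [slope_def_field]
    fun_prop
  · filter_upwards [hball] with t ht
    filter_upwards [hd] with x hx
    have hslope : |slope (Φ · x) t₀ t| ≤ b x :=
      norm_slope_le_of_norm_hasDerivWithinAt_le (convex_ball t₀ δ)
        (fun s hs => (hx s hs).1.hasDerivWithinAt) (fun s hs => (hx s hs).2) ht₀ ht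
    refine ENNReal.ofReal_le_ofReal (sq_le_sq.2 (le_trans ?_ (le_abs_self _)))
    linarith [abs_sub (slope (Φ · x) t₀ t) (Φ' t₀ x), (hx t₀ ht₀).2]
  · rw [lintegral_ofReal_sq]
    exact ENNReal.pow_ne_top (hb.const_mul 2).eLpNorm_ne_top
  · filter_upwards [hd] with x hx
    have hlim := (hasDerivAt_iff_tendsto_slope.1 (hx t₀ ht₀).1).sub_const (Φ' t₀ x)
    simpa using ENNReal.tendsto_ofReal (hlim.pow 2)

theorem HasIntegral.hasDerivAt [NormedSpace ℝ H] [IsScalarTower ℝ 𝕜 H] (hδ : 0 < δ)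
    (hw : ∀ t ∈ Metric.ball t₀ δ, E.HasIntegral (Φ t) f (w t)) (hu : E.HasIntegral (Φ' t₀) f u)
    (hb : MemLp b 2 (E.scalarMeasure f))
    (hd : ∀ᵐ x ∂(E.scalarMeasure f), ∀ t ∈ Metric.ball t₀ δ,
      HasDerivAt (Φ · x) (Φ' t x) t ∧ |Φ' t x| ≤ b x) :
    HasDerivAt w u t₀ := by
  rw [hasDerivAt_iff_tendsto_slope, tendsto_iff_edist_tendsto_0]
  refine (tendsto_eLpNorm_slope_sub hδ hb (fun t ht => (hw t ht).measurable) hu.measurable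
    hd).congr' ?_
  filter_upwards [nhdsWithin_le_nhds (Metric.ball_mem_nhds t₀ hδ)] with t ht
  have hslope := (((hw t ht).sub (hw t₀ (Metric.mem_ball_self hδ))).const_mul (t - t₀)⁻¹).sub hu
  rw [← RCLike.real_smul_eq_coe_smul (K := 𝕜), ← slope_def_module] at hslope
  rw [edist_eq_enorm_sub, hslope.enorm_eq]
  rfl

end Derivative

/-- The spectral measure is concentrated on `(0, ∞)`, as for the spectral resolution of a
nonnegative injective operator. -/
def IsPositive (E : SpectralMeasure 𝕜 H) : Prop := E.proj (Set.Iic 0) = 0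

/-- The vector `∫ φ(λ) dE(λ) f` (arbitrary if `f` is not in the domain of the integral). -/
def integral (E : SpectralMeasure 𝕜 H) (φ : ℝ → ℝ) (f : H) : H :=
  Classical.epsilon fun u => E.HasIntegral φ f u

namespace IsPositive

theorem ae_pos (hE : E.IsPositive) (f : H) : ∀ᵐ x ∂(E.scalarMeasure f), 0 < x := by
  have hIic : E.scalarMeasure f (Set.Iic 0) = 0 := by
    rw [E.scalarMeasure_apply _ measurableSet_Iic, hE, zero_apply]
    simp
  simpa [ae_iff, Set.Iic] using hIic

theorem hasIntegral_integral (hE : E.IsPositive) (hm : Measurable φ)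
    (hb : ∀ x, 0 < x → |φ x| ≤ C) (f : H) : E.HasIntegral φ f (E.integral φ f) :=
  Classical.epsilon_spec (exists_hasIntegral_of_ae_le hm ((hE.ae_pos f).mono hb))

theorem enorm_le (hE : E.IsPositive) (hu : E.HasIntegral φ f u) (hv : E.HasIntegral ψ f v)
    (h : ∀ x, 0 < x → |φ x| ≤ C * |ψ x|) : ‖u‖ₑ ≤ ENNReal.ofReal C * ‖v‖ₑ :=
  hu.enorm_le hv ((hE.ae_pos f).mono h)

theorem congr (hE : E.IsPositive) (hu : E.HasIntegral φ f u) (hm : Measurable ψ)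
    (h : ∀ x, 0 < x → φ x = ψ x) : E.HasIntegral ψ f u :=
  hu.congr hm ((hE.ae_pos f).mono h)

theorem isLinearMap_integral (hE : E.IsPositive) (hm : Measurable φ)
    (hb : ∀ x, 0 < x → |φ x| ≤ C) : IsLinearMap 𝕜 (E.integral φ) := by
  have hsymm (f g : H) : ⟪E.integral φ f, g⟫_𝕜 = ⟪f, E.integral φ g⟫_𝕜 :=
    (hE.hasIntegral_integral hm hb f).inner_left (hE.hasIntegral_integral hm hb g)
  exact ⟨fun f g => ext_inner_right 𝕜 fun h => by simp only [inner_add_left, hsymm],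
    fun c f => ext_inner_right 𝕜 fun h => by simp only [inner_smul_left, hsymm]⟩

theorem eq_zero_of_hasIntegral_zero (hE : E.IsPositive) (hu : E.HasIntegral φ f 0)
    (h : ∀ x, 0 < x → φ x ≠ 0) : f = 0 := by
  have hφ : φ =ᵐ[E.scalarMeasure f] 0 := by
    rw [← eLpNorm_eq_zero_iff hu.measurable.aestronglyMeasurable two_ne_zero, ← hu.enorm_eq,
      enorm_zero]
  have hfalse : ∀ᵐ _ ∂(E.scalarMeasure f), False := by
    filter_upwards [hφ, hE.ae_pos f] with x hx hpos using h x hpos hx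
  have huniv : E.scalarMeasure f Set.univ = 0 := by simpa [ae_iff] using hfalse
  simpa [E.scalarMeasure_univ] using huniv

end IsPositive

end SpectralMeasure

end SpectralCalculus

section Bessel

theorem exists_rpow_le_mul_exp {p ε : ℝ} (hp : 0 ≤ p) (hε : 0 < ε) :
    ∃ C : ℝ, 0 < C ∧ ∀ y : ℝ, 0 ≤ y → y ^ p ≤ C * Real.exp (ε * y) := by
  rcases hp.eq_or_lt with rfl | hp
  · exact ⟨1, one_pos, fun y hy => by simpa using by positivity⟩
  refine ⟨(p / ε) ^ p, by positivity, fun y hy => ?_⟩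
  have hexp : ε * y / p ≤ Real.exp (ε * y / p) := by linarith [Real.add_one_le_exp (ε * y / p)]
  calc y ^ p = (p / ε) ^ p * (ε * y / p) ^ p := by
        rw [← Real.mul_rpow (by positivity) (by positivity)]; congr 1; field_simp
    _ ≤ (p / ε) ^ p * Real.exp (ε * y / p) ^ p := by gcongr
    _ = (p / ε) ^ p * Real.exp (ε * y) := by
        rw [← Real.exp_mul, div_mul_cancel₀ _ hp.ne']

variable {r r' x : ℝ}

@[fun_prop]
theorem measurable_besselSymbol (r : ℝ) : Measurable (besselSymbol r) := by
  unfold besselSymbol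
  fun_prop

theorem besselSymbol_pos (r : ℝ) (hx : 0 < x) : 0 < besselSymbol r x :=
  Real.rpow_pos_of_pos (by linarith) _

theorem besselSymbol_mul (r r' : ℝ) (hx : 0 < x) :
    besselSymbol r x * besselSymbol r' x = besselSymbol (r + r') x := by
  unfold besselSymbol
  rw [← Real.rpow_add (by linarith), add_div]

theorem besselSymbol_zero (x : ℝ) : besselSymbol 0 x = 1 := by simp [besselSymbol]

theorem besselSymbol_mono (h : r ≤ r') (hx : 0 < x) : besselSymbol r x ≤ besselSymbol r' x :=
  Real.rpow_le_rpow_of_exponent_le (by linarith) (by linarith)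

theorem besselSymbol_le_one (h : r ≤ 0) (hx : 0 < x) : besselSymbol r x ≤ 1 :=
  (besselSymbol_mono h hx).trans_eq (besselSymbol_zero x)

theorem abs_besselSymbol_neg_le_one (hr : 0 ≤ r) (hx : 0 < x) :
    |besselSymbol (-r) x| ≤ 1 := by
  rw [abs_of_pos (besselSymbol_pos _ hx)]
  exact besselSymbol_le_one (neg_nonpos.2 hr) hx

theorem abs_exp_neg_mul_le_one {t : ℝ} (ht : 0 < t) (hx : 0 < x) :
    |Real.exp (-(t * x))| ≤ 1 := by
  rw [Real.abs_exp, Real.exp_le_one_iff, neg_nonpos]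
  positivity

theorem exists_abs_exp_mul_besselSymbol_le (r : ℝ) {t : ℝ} (ht : 0 < t) :
    ∃ C : ℝ, ∀ x, 0 < x → |Real.exp (-(t * x)) * besselSymbol r x| ≤ C := by
  obtain ⟨C, -, hC⟩ := exists_rpow_le_mul_exp (p := max r 0 / 2) (by positivity) ht
  refine ⟨C * Real.exp t, fun x hx => ?_⟩
  rw [abs_of_pos (mul_pos (Real.exp_pos _) (besselSymbol_pos r hx))]
  calc Real.exp (-(t * x)) * besselSymbol r x
      ≤ Real.exp (-(t * x)) * besselSymbol (max r 0) x := by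
        gcongr; exact besselSymbol_mono (le_max_left _ _) hx
    _ ≤ Real.exp (-(t * x)) * (C * Real.exp (t * (1 + x))) := by
        gcongr; exact hC (1 + x) (by linarith)
    _ = C * Real.exp t := by
        rw [mul_left_comm, ← Real.exp_add]; congr 2; ring

end Bessel

section Interpolation

variable {X F : Type*} [MeasurableSpace X] {μ : Measure X} [NormedAddCommGroup F] {v f : X → F}
  {q : ℝ}

theorem lintegral_enorm_rpow_mul_le (hv : AEStronglyMeasurable v μ)
    (hf : AEStronglyMeasurable f μ) (hq : 1 ≤ q) :
    ∫⁻ x, ‖v x‖ₑ ^ (2 - 2 / q) * ‖f x‖ₑ ∂μ ≤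
      eLpNorm v 2 μ ^ (2 - 2 / q) * eLpNorm f (ENNReal.ofReal q) μ := by
  have hq₀ : 0 < q := by linarith
  have hexp : 2 * (1 - 1 / q) = 2 - 2 / q := by ring
  have holder := ENNReal.lintegral_mul_norm_pow_le (μ := μ) (p := 1 - 1 / q) (q := 1 / q)
    (hv.enorm.pow_const (2 : ℝ)) (hf.enorm.pow_const q)
    (by rw [sub_nonneg, div_le_one hq₀]; exact hq) (by positivity) (by ring)
  simp only [← ENNReal.rpow_mul, hexp, mul_one_div_cancel hq₀.ne', ENNReal.rpow_one] at holder
  refine holder.trans_eq ?_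
  rw [eLpNorm_eq_lintegral_rpow_enorm_toReal two_ne_zero ENNReal.ofNat_ne_top,
    eLpNorm_eq_lintegral_rpow_enorm_toReal (by simpa using hq₀) ENNReal.ofReal_ne_top,
    ENNReal.toReal_ofReal hq₀.le, ← ENNReal.rpow_mul, ENNReal.toReal_ofNat, ← hexp, ← mul_assoc,
    one_div_mul_cancel two_ne_zero, one_mul]

theorem lintegral_enorm_mul_le (hv : AEStronglyMeasurable v μ) (hf : AEStronglyMeasurable f μ)
    (hq : 1 ≤ q) (hq' : q ≤ 2) :
    ∫⁻ x, ‖v x‖ₑ * ‖f x‖ₑ ∂μ ≤ eLpNorm v ⊤ μ ^ (2 / q - 1) * eLpNorm v 2 μ ^ (2 - 2 / q) *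
      eLpNorm f (ENNReal.ofReal q) μ := by
  have hq₀ : 0 < q := by linarith
  have hθ : 0 ≤ 2 / q - 1 := by rw [sub_nonneg, one_le_div hq₀]; exact hq'
  have hθ' : 0 ≤ 2 - 2 / q := by rw [sub_nonneg, div_le_iff₀ hq₀]; linarith
  have hsplit : ∀ᵐ x ∂μ, ‖v x‖ₑ * ‖f x‖ₑ ≤
      eLpNorm v ⊤ μ ^ (2 / q - 1) * (‖v x‖ₑ ^ (2 - 2 / q) * ‖f x‖ₑ) := by
    filter_upwards [enorm_ae_le_eLpNormEssSup v μ] with x hx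
    calc ‖v x‖ₑ * ‖f x‖ₑ = ‖v x‖ₑ ^ (2 / q - 1) * (‖v x‖ₑ ^ (2 - 2 / q) * ‖f x‖ₑ) := by
          rw [← mul_assoc, ← ENNReal.rpow_add_of_nonneg _ _ hθ hθ', sub_add_sub_cancel',
            (by norm_num : (2 - 1 : ℝ) = 1), ENNReal.rpow_one]
      _ ≤ _ := by rw [eLpNorm_exponent_top]; gcongr
  have hm : AEMeasurable (fun x => ‖v x‖ₑ ^ (2 - 2 / q) * ‖f x‖ₑ) μ :=
    (hv.enorm.pow_const _).mul hf.enorm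
  refine (lintegral_mono_ae hsplit).trans ?_
  rw [lintegral_const_mul'' _ hm, mul_assoc]
  gcongr
  exact lintegral_enorm_rpow_mul_le hv hf hq

theorem enorm_integral_inner_le {𝕜 : Type*} [RCLike 𝕜] [InnerProductSpace 𝕜 F]
    (hv : AEStronglyMeasurable v μ) (hf : AEStronglyMeasurable f μ) (hq : 1 ≤ q) (hq' : q ≤ 2)
    {a b : ℝ≥0∞} (htop : eLpNorm v ⊤ μ ≤ a * b) (htwo : eLpNorm v 2 μ ≤ b) :
    ‖∫ x, ⟪v x, f x⟫_𝕜 ∂μ‖ₑ ≤ b * (a ^ (2 / q - 1) * eLpNorm f (ENNReal.ofReal q) μ) := by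
  have hq₀ : 0 < q := by linarith
  have hθ : 0 ≤ 2 / q - 1 := by rw [sub_nonneg, one_le_div hq₀]; exact hq'
  have hθ' : 0 ≤ 2 - 2 / q := by rw [sub_nonneg, div_le_iff₀ hq₀]; linarith
  calc ‖∫ x, ⟪v x, f x⟫_𝕜 ∂μ‖ₑ ≤ ∫⁻ x, ‖⟪v x, f x⟫_𝕜‖ₑ ∂μ := enorm_integral_le_lintegral_enorm _
    _ ≤ ∫⁻ x, ‖v x‖ₑ * ‖f x‖ₑ ∂μ := by
        refine lintegral_mono fun x => ?_
        simpa only [enorm_eq_nnnorm, ← ENNReal.coe_mul, ENNReal.coe_le_coe] using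
          nnnorm_inner_le_nnnorm (𝕜 := 𝕜) (v x) (f x)
    _ ≤ eLpNorm v ⊤ μ ^ (2 / q - 1) * eLpNorm v 2 μ ^ (2 - 2 / q) * eLpNorm f (.ofReal q) μ :=
        lintegral_enorm_mul_le hv hf hq hq'
    _ ≤ (a * b) ^ (2 / q - 1) * b ^ (2 - 2 / q) * eLpNorm f (.ofReal q) μ := by gcongr
    _ = b ^ (2 / q - 1 + (2 - 2 / q)) * (a ^ (2 / q - 1) * eLpNorm f (.ofReal q) μ) := by
        rw [ENNReal.mul_rpow_of_nonneg _ _ hθ, ENNReal.rpow_add_of_nonneg _ _ hθ hθ']; ring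
    _ = _ := by
        rw [sub_add_sub_cancel', (by norm_num : (2 - 1 : ℝ) = 1), ENNReal.rpow_one]

theorem eLpNorm_le_tsum_of_hasSum {r p : ℝ≥0∞} [Fact (1 ≤ r)] (hp : 1 ≤ p) {u : ℕ → Lp F r μ}
    {w : Lp F r μ} (hu : HasSum u w) : eLpNorm w p μ ≤ ∑' j, eLpNorm (u j) p μ := by
  refine eLpNorm_le_of_tendstoInMeasure (.of_forall fun n => ?_)
    (tendstoInMeasure_of_tendsto_Lp hu.tendsto_sum_nat) fun n => Lp.aestronglyMeasurable _
  rw [eLpNorm_congr_ae (Lp.coeFn_finsetSum _ _)]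
  exact (eLpNorm_sum_le (fun j _ => Lp.aestronglyMeasurable (u j)) hp).trans
    (ENNReal.sum_le_tsum _)

end Interpolation

section Lebesgue

variable {X 𝕜 : Type*} [RCLike 𝕜] [MeasurableSpace X] {μ : Measure X} {α C : ℝ}

namespace SpectralMeasure

variable {E : SpectralMeasure 𝕜 (Lp 𝕜 2 μ)} {φ ψ : ℝ → ℝ} {f h u : Lp 𝕜 2 μ} {M t : ℝ}

/-- The ultracontractive bound `‖e^{-tA} f‖_{L^∞} ≤ C t^{-α} ‖f‖_{L²}` for `A = ∫ λ dE(λ)`. -/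
def HeatBound (E : SpectralMeasure 𝕜 (Lp 𝕜 2 μ)) (α C : ℝ) : Prop :=
  ∀ t : ℝ, 0 < t → ∀ f u : Lp 𝕜 2 μ, E.HasIntegral (fun x => Real.exp (-(t * x))) f u →
    eLpNorm u ⊤ μ ≤ ENNReal.ofReal (C * t ^ (-α)) * ‖f‖ₑ

theorem HeatBound.eLpNorm_top_le (hH : E.HeatBound α C) (ht : 0 < t) (hu : E.HasIntegral ψ f u)
    (hM : ∀ᵐ x ∂(E.scalarMeasure f), |Real.exp (t * x) * ψ x| ≤ M) :
    eLpNorm u ⊤ μ ≤ ENNReal.ofReal (C * t ^ (-α)) * (ENNReal.ofReal M * ‖f‖ₑ) := by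
  have hψ := hu.measurable
  obtain ⟨g, hg⟩ := exists_hasIntegral_of_ae_le (by fun_prop) hM
  have hheat : E.HasIntegral (fun x => Real.exp (-(t * x))) g u := by
    refine hg.comp (by fun_prop) ?_
    convert hu using 1
    ext x
    rw [Pi.mul_apply, ← mul_assoc, ← Real.exp_add, neg_add_cancel, Real.exp_zero, one_mul]
  refine (hH t ht g u hheat).trans ?_
  gcongr
  exact hg.enorm_le (hasIntegral_one f) (by simpa using hM)

/-- On the range of `E((-∞, 0])` the operators `e^{tA}`, `t > 0`, are contractions, so that a vector
of this range is `e^{-tA} g` with `‖g‖` bounded as `t → ∞`. -/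
theorem HeatBound.isPositive (hα : 0 < α) (hH : E.HeatBound α C) : E.IsPositive := by
  ext1 f
  have hbound (t : ℝ) (ht : 0 < t) : eLpNorm (E.proj (Set.Iic 0) f) ⊤ μ ≤
      ENNReal.ofReal (C * t ^ (-α)) * (ENNReal.ofReal 1 * ‖f‖ₑ) := by
    refine hH.eLpNorm_top_le ht ((hasIntegral_one f).proj measurableSet_Iic)
      (.of_forall fun x => ?_)
    by_cases hx : x ≤ 0
    · simpa [Set.indicator_of_mem (Set.mem_Iic.2 hx)] using mul_nonpos_of_nonneg_of_nonpos ht.le hx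
    · simp [Set.indicator_of_notMem (Set.mem_Iic.not.2 hx)]
  have hlim : Tendsto (fun t : ℝ => ENNReal.ofReal (C * t ^ (-α)) * (ENNReal.ofReal 1 * ‖f‖ₑ))
      atTop (𝓝 0) := by
    have hdecay := ENNReal.tendsto_ofReal ((tendsto_rpow_neg_atTop hα).const_mul C)
    simpa using ENNReal.Tendsto.mul_const hdecay (.inr (by finiteness))
  have hzero : eLpNorm (E.proj (Set.Iic 0) f) ⊤ μ = 0 :=
    le_antisymm (ge_of_tendsto hlim ((eventually_gt_atTop 0).mono hbound)) zero_le
  exact Lp.eq_zero_iff_ae_eq_zero.2 <|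
    (eLpNorm_eq_zero_iff (Lp.aestronglyMeasurable _) ENNReal.top_ne_zero).1 hzero

theorem IsPositive.hasIntegral_exp (hE : E.IsPositive) (ht : 0 < t) (g : Lp 𝕜 2 μ) :
    E.HasIntegral (fun x => Real.exp (-(t * x))) g
      (E.integral (fun x => Real.exp (-(t * x))) g) :=
  hE.hasIntegral_integral (by fun_prop) (fun _ => abs_exp_neg_mul_le_one ht) g

theorem IsPositive.hasIntegral_exp_mul_besselSymbol (hE : E.IsPositive) (γ : ℝ) (ht : 0 < t)
    (g : Lp 𝕜 2 μ) :
    E.HasIntegral (fun x => Real.exp (-(t * x)) * besselSymbol γ x) g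
      (E.integral (fun x => Real.exp (-(t * x)) * besselSymbol γ x) g) :=
  let ⟨_, hC⟩ := exists_abs_exp_mul_besselSymbol_le γ ht
  hE.hasIntegral_integral (by fun_prop) hC g

/-- `f = (I + A)^{-γ/2} h` in the sense of the pairing with the range of the heat semigroup:
`⟨g, e^{-tA} (I + A)^{-γ/2} h⟩ = ∫ ⟨e^{-tA} g, f⟩ dμ` for all `t > 0` and `g ∈ L²`. This makes sense
for `γ` of either sign and for functions `f` that are not in `L²`. -/
def Represents (E : SpectralMeasure 𝕜 (Lp 𝕜 2 μ)) (γ : ℝ) (f : X → 𝕜) (h : Lp 𝕜 2 μ) : Prop :=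
  ∀ t : ℝ, 0 < t → ∀ g : Lp 𝕜 2 μ,
    ⟪g, E.integral (fun x => Real.exp (-(t * x)) * besselSymbol (-γ) x) h⟫_𝕜 =
      ∫ x, ⟪E.integral (fun x => Real.exp (-(t * x))) g x, f x⟫_𝕜 ∂μ

theorem Represents.unique (hE : E.IsPositive) {γ : ℝ} {f : X → 𝕜} {h' : Lp 𝕜 2 μ}
    (hh : E.Represents γ f h) (hh' : E.Represents γ f h') : h = h' := by
  set φ : ℝ → ℝ := fun x => Real.exp (-(1 * x)) * besselSymbol (-γ) x
  obtain ⟨C, hC⟩ := exists_abs_exp_mul_besselSymbol_le (-γ) one_pos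
  have heq : E.integral φ h = E.integral φ h' :=
    ext_inner_left 𝕜 fun g => (hh 1 one_pos g).trans (hh' 1 one_pos g).symm
  have hzero : E.integral φ (h - h') = 0 := by
    rw [(hE.isLinearMap_integral (by fun_prop) hC).map_sub, heq, sub_self]
  have hbessel := hE.hasIntegral_exp_mul_besselSymbol (-γ) one_pos (h - h')
  rw [hzero] at hbessel
  exact sub_eq_zero.1 <| hE.eq_zero_of_hasIntegral_zero hbessel fun x hx =>
    (mul_pos (Real.exp_pos _) (besselSymbol_pos _ hx)).ne'

/-- The `L^q → L²` smoothing of the heat semigroup, dual to the interpolation of `L² → L^∞` and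
`L² → L²`: test with `g = e^{-tA} f`. -/
theorem Represents.enorm_integral_exp_le (hE : E.IsPositive) (hH : E.HeatBound α C)
    {γ q : ℝ} (hq : 1 ≤ q) (hq' : q ≤ 2) {f : X → 𝕜} (hf : AEStronglyMeasurable f μ)
    (hh : E.Represents γ f h) (ht : 0 < t) :
    ‖E.integral (fun x => Real.exp (-(t * x)) * besselSymbol (-γ) x) h‖ₑ ≤
      ENNReal.ofReal (C * t ^ (-α)) ^ (2 / q - 1) * eLpNorm f (ENNReal.ofReal q) μ := by
  set u := E.integral (fun x => Real.exp (-(t * x)) * besselSymbol (-γ) x) h with hu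
  have hv := hE.hasIntegral_exp ht u
  have htwo : eLpNorm (E.integral (fun x => Real.exp (-(t * x))) u) 2 μ ≤ ‖u‖ₑ := by
    rw [← Lp.enorm_def]
    simpa using hE.enorm_le hv (hasIntegral_one u) (C := 1)
      fun x hx => by simpa using abs_exp_neg_mul_le_one ht hx
  have hsq : ‖u‖ₑ * ‖u‖ₑ = ‖∫ x, ⟪E.integral (fun x => Real.exp (-(t * x))) u x, f x⟫_𝕜 ∂μ‖ₑ := by
    rw [← hh t ht u, ← hu, inner_self_eq_norm_sq_to_K, enorm_pow, sq,
      ← ofReal_norm (RCLike.ofReal _), RCLike.norm_ofReal, abs_norm, ofReal_norm]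
  have hle := enorm_integral_inner_le (𝕜 := 𝕜) (Lp.aestronglyMeasurable _) hf hq hq'
    (hH t ht u _ hv) htwo
  rw [← hsq] at hle
  rcases eq_or_ne ‖u‖ₑ 0 with h₀ | h₀
  · exact h₀ ▸ zero_le
  · exact (ENNReal.mul_le_mul_iff_right h₀ enorm_ne_top).1 hle

end SpectralMeasure

/-- The dyadic decomposition `(-∞, 1], (1, 2], (2, 4], …` of the line. -/
def dyadicShell : ℕ → Set ℝ := disjointed fun j => Set.Iic (2 ^ j)

theorem measurableSet_dyadicShell (j : ℕ) : MeasurableSet (dyadicShell j) :=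
  .disjointed (fun _ => measurableSet_Iic) j

theorem le_of_mem_dyadicShell {j : ℕ} {x : ℝ} (hx : x ∈ dyadicShell j) : x ≤ 2 ^ j :=
  disjointed_subset _ j hx

theorem half_le_of_mem_dyadicShell {j : ℕ} {x : ℝ} (hx : x ∈ dyadicShell j) (hx₀ : 0 < x) :
    (2 : ℝ) ^ j / 2 ≤ 1 + x := by
  cases j with
  | zero => linarith [pow_zero (2 : ℝ)]
  | succ i =>
    have hmono : Monotone fun j : ℕ => Set.Iic ((2 : ℝ) ^ j) := fun i j hij =>
      Set.Iic_subset_Iic.2 (pow_le_pow_right₀ one_le_two hij)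
    rw [dyadicShell, hmono.disjointed_add_one] at hx
    have hlt : 2 ^ i < x := not_le.1 hx.2
    rw [pow_succ]
    linarith

theorem iUnion_dyadicShell : ⋃ j, dyadicShell j = Set.univ := by
  rw [dyadicShell, iUnion_disjointed, Set.eq_univ_iff_forall]
  exact fun x => Set.mem_iUnion.2 ((pow_unbounded_of_one_lt x one_lt_two).imp fun _ => le_of_lt)

namespace SpectralMeasure

variable {E : SpectralMeasure 𝕜 (Lp 𝕜 2 μ)} {ψ : ℝ → ℝ} {h u : Lp 𝕜 2 μ} {M σ : ℝ}

theorem hasSum_proj_dyadicShell (E : SpectralMeasure 𝕜 (Lp 𝕜 2 μ)) (u : Lp 𝕜 2 μ) :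
    HasSum (fun j => E.proj (dyadicShell j) u) u := by
  have hsum := E.hasSum_iUnion dyadicShell measurableSet_dyadicShell (disjoint_disjointed _) u
  rwa [iUnion_dyadicShell, E.proj_univ] at hsum

theorem HeatBound.eLpNorm_top_proj_dyadicShell_le (hC : 0 ≤ C) (hE : E.IsPositive)
    (hH : E.HeatBound α C) (hσ : 0 ≤ σ) (hM : 0 ≤ M)
    (hψ : ∀ x, 0 < x → |ψ x| ≤ M * besselSymbol (-σ) x) (hu : E.HasIntegral ψ h u) (j : ℕ) :
    eLpNorm (E.proj (dyadicShell j) u) ⊤ μ ≤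
      ENNReal.ofReal (C * Real.exp 1 * 2 ^ (σ / 2) * M * (2 ^ (α - σ / 2)) ^ j) * ‖h‖ₑ := by
  have hbound : ∀ᵐ x ∂(E.scalarMeasure h),
      |Real.exp ((2 ^ j)⁻¹ * x) * (dyadicShell j).indicator ψ x| ≤
        Real.exp 1 * (M * (2 ^ j / 2) ^ (-σ / 2)) := by
    filter_upwards [hE.ae_pos h] with x hx
    by_cases hxj : x ∈ dyadicShell j
    · rw [Set.indicator_of_mem hxj, abs_mul, Real.abs_exp]
      have hexp : (2 ^ j)⁻¹ * x ≤ 1 := by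
        rw [inv_mul_le_iff₀ (by positivity), mul_one]
        exact le_of_mem_dyadicShell hxj
      have hbessel : besselSymbol (-σ) x ≤ (2 ^ j / 2) ^ (-σ / 2) :=
        Real.rpow_le_rpow_of_nonpos (by positivity) (half_le_of_mem_dyadicShell hxj hx)
          (by linarith)
      gcongr
      exact (hψ x hx).trans (by gcongr)
    · rw [Set.indicator_of_notMem hxj, mul_zero, abs_zero]
      positivity
  have hpow (r : ℝ) : ((2 : ℝ) ^ j) ^ r = (2 ^ r) ^ j := by
    rw [← Real.rpow_natCast, ← Real.rpow_natCast, ← Real.rpow_mul zero_le_two,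
      ← Real.rpow_mul zero_le_two, mul_comm]
  refine (hH.eLpNorm_top_le (t := (2 ^ j)⁻¹) (by positivity)
    (hu.proj (measurableSet_dyadicShell j)) hbound).trans_eq ?_
  rw [← mul_assoc, ← ENNReal.ofReal_mul (by positivity)]
  congr 2
  rw [Real.inv_rpow (by positivity), Real.rpow_neg (by positivity), inv_inv,
    Real.div_rpow (by positivity) zero_le_two, hpow, hpow, neg_div, Real.rpow_neg zero_le_two,
    Real.rpow_sub two_pos, div_pow, inv_pow]
  field_simp

/-- For `A = ∫ λ dE(λ)`, the bound `‖ψ(A) h‖_{L^p} ≤ K M ‖h‖_{L²}` for all symbols with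
`|ψ(λ)| ≤ M (1 + λ)^{-σ/2}`; for `ψ(λ) = (1 + λ)^{-σ/2}` it is the embedding `H^σ(A) ⊂ L^p`. -/
def SobolevEmbedding (E : SpectralMeasure 𝕜 (Lp 𝕜 2 μ)) (σ K : ℝ) (p : ℝ≥0∞) : Prop :=
  ∀ (ψ : ℝ → ℝ) (h u : Lp 𝕜 2 μ) (M : ℝ), 0 ≤ M →
    (∀ x, 0 < x → |ψ x| ≤ M * besselSymbol (-σ) x) → E.HasIntegral ψ h u →
    eLpNorm u p μ ≤ ENNReal.ofReal (K * M) * ‖h‖ₑ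

/-- On the shell `λ ≈ 2^j` the heat bound at the time `2^{-j}` costs `2^{jα}`, while
`(I + A)^{-σ/2}` gains `2^{-jσ/2}`. -/
theorem HeatBound.exists_sobolevEmbedding (hC : 0 < C) (hE : E.IsPositive) (hH : E.HeatBound α C)
    (hσ : 0 ≤ σ) (hασ : 2 * α < σ) :
    ∃ K : ℝ, 0 < K ∧ E.SobolevEmbedding σ K ⊤ := by
  set ρ : ℝ := 2 ^ (α - σ / 2)
  have hρ₀ : 0 < ρ := by positivity
  have hρ₁ : ρ < 1 := Real.rpow_lt_one_of_one_lt_of_neg one_lt_two (by linarith)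
  refine ⟨C * Real.exp 1 * 2 ^ (σ / 2) * (1 - ρ)⁻¹,
    mul_pos (by positivity) (inv_pos.2 (by linarith)), fun ψ h u M hM hψ hu => ?_⟩
  calc eLpNorm u ⊤ μ ≤ ∑' j, eLpNorm (E.proj (dyadicShell j) u) ⊤ μ :=
        eLpNorm_le_tsum_of_hasSum le_top (E.hasSum_proj_dyadicShell u)
    _ ≤ ∑' j : ℕ, ENNReal.ofReal (C * Real.exp 1 * 2 ^ (σ / 2) * M * ρ ^ j) * ‖h‖ₑ :=
        ENNReal.tsum_le_tsum (hH.eLpNorm_top_proj_dyadicShell_le hC.le hE hσ hM hψ hu)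
    _ = ENNReal.ofReal (C * Real.exp 1 * 2 ^ (σ / 2) * M * (1 - ρ)⁻¹) * ‖h‖ₑ := by
        rw [ENNReal.tsum_mul_right, ← ENNReal.ofReal_tsum_of_nonneg (fun j => by positivity)
          ((summable_geometric_of_lt_one hρ₀.le hρ₁).mul_left _), tsum_mul_left,
          tsum_geometric_of_lt_one hρ₀.le hρ₁]
    _ = _ := by congr 2; ring

end SpectralMeasure

end Lebesgue

section Sobolev

variable {X 𝕜 : Type*} [RCLike 𝕜] [MeasurableSpace X] {μ : Measure X}
  {A : Lp 𝕜 2 μ →ₗ.[𝕜] Lp 𝕜 2 μ} {r α C : ℝ} {f : X → 𝕜} {h v y : Lp 𝕜 2 μ}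

namespace SpectralMeasure

variable {E : SpectralMeasure 𝕜 (Lp 𝕜 2 μ)}

theorem IsPositive.hasIntegral_besselSymbol_neg (hE : E.IsPositive)
    (hv : E.HasIntegral (besselSymbol r) v y) : E.HasIntegral (besselSymbol (-r)) y v := by
  refine hv.comp (by fun_prop) (hE.congr (hasIntegral_one v) (by fun_prop) fun x hx => ?_)
  rw [Pi.mul_apply, besselSymbol_mul _ _ hx, neg_add_cancel, besselSymbol_zero, Pi.one_apply]

theorem IsPositive.hasIntegral_besselSymbol (hE : E.IsPositive) (hr : 0 ≤ r) (y : Lp 𝕜 2 μ) :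
    E.HasIntegral (besselSymbol r) (E.integral (besselSymbol (-r)) y) y := by
  have hbessel := hE.hasIntegral_besselSymbol_neg
    (hE.hasIntegral_integral (by fun_prop) (fun _ => abs_besselSymbol_neg_le_one hr) y)
  rwa [neg_neg] at hbessel

end SpectralMeasure

open SpectralMeasure

theorem enorm_le_dualNorm_mul {F : sobolevSpace A r →ₗ⋆[𝕜] 𝕜} (hF : dualNorm A r F < ⊤)
    (hv : (spectralResolution A).HasIntegral (besselSymbol r) v y) :
    ‖F ⟨v, hv.2.1⟩‖ₑ ≤ dualNorm A r F * ‖y‖ₑ := by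
  have hnorm : sobolevNorm A r v ≤ ‖y‖ₑ := iInf₂_le y hv
  have hdiv : ‖F ⟨v, hv.2.1⟩‖ₑ / sobolevNorm A r v ≤ dualNorm A r F :=
    le_iSup (fun g : sobolevSpace A r => ‖F g‖ₑ / sobolevNorm A r (g : Lp 𝕜 2 μ)) ⟨v, hv.2.1⟩
  rw [ENNReal.div_le_iff_le_mul (.inr hF.ne) (.inl (hnorm.trans_lt enorm_lt_top).ne)] at hdiv
  exact hdiv.trans (by gcongr)

/-- The Riesz representation theorem in `H^r(A)`, transported to `L²` by `(I + A)^{r/2}`. -/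
theorem exists_inner_eq_of_dualNorm_lt_top (hE : (spectralResolution A).IsPositive) (hr : 0 ≤ r)
    {F : sobolevSpace A r →ₗ⋆[𝕜] 𝕜} (hF : dualNorm A r F < ⊤) :
    ∃ h : Lp 𝕜 2 μ, ‖h‖ₑ ≤ dualNorm A r F ∧ ∀ v y,
      (hv : (spectralResolution A).HasIntegral (besselSymbol r) v y) →
        F ⟨v, hv.2.1⟩ = ⟪y, h⟫_𝕜 := by
  have hbessel := hE.hasIntegral_besselSymbol hr
  let P : Lp 𝕜 2 μ →ₗ[𝕜] sobolevSpace A r :=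
    ((hE.isLinearMap_integral (measurable_besselSymbol _)
      fun _ => abs_besselSymbol_neg_le_one hr).mk' _).codRestrict _ fun y => (hbessel y).2.1
  let ℓ : Lp 𝕜 2 μ →ₗ[𝕜] 𝕜 := (starLinearEquiv 𝕜).toLinearMap.comp (F.comp P)
  have hℓ (y : Lp 𝕜 2 μ) : ‖ℓ y‖ ≤ (dualNorm A r F).toReal * ‖y‖ := by
    have hle := ENNReal.toReal_mono (ENNReal.mul_ne_top hF.ne enorm_ne_top)
      (enorm_le_dualNorm_mul hF (hbessel y))
    rw [ENNReal.toReal_mul, toReal_enorm, toReal_enorm] at hle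
    exact (norm_star (F (P y))).trans_le hle
  refine ⟨(InnerProductSpace.toDual 𝕜 _).symm (ℓ.mkContinuous _ hℓ), ?_, fun v y hv => ?_⟩
  · rw [← ofReal_norm, LinearIsometryEquiv.norm_map]
    exact (ENNReal.ofReal_le_ofReal (ℓ.mkContinuous_norm_le ENNReal.toReal_nonneg hℓ)).trans_eq
      (ENNReal.ofReal_toReal hF.ne)
  · have hPy : P y = ⟨v, hv.2.1⟩ := Subtype.ext
      ((hE.hasIntegral_besselSymbol_neg (hbessel y)).unique (hE.hasIntegral_besselSymbol_neg hv))
    rw [← inner_conj_symm, InnerProductSpace.toDual_symm_apply, ← hPy]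
    exact (star_star (F (P y))).symm

theorem IsDualElement.represents (hE : (spectralResolution A).IsPositive)
    (hH : (spectralResolution A).HeatBound α C) {F : sobolevSpace A r →ₗ⋆[𝕜] 𝕜}
    (hF : IsDualElement A r f F)
    (hinner : ∀ v y, (hv : (spectralResolution A).HasIntegral (besselSymbol r) v y) →
      F ⟨v, hv.2.1⟩ = ⟪y, h⟫_𝕜) : (spectralResolution A).Represents (-r) f h := by
  intro t ht g
  have hexp := hE.hasIntegral_exp ht g
  have hg := hE.hasIntegral_exp_mul_besselSymbol r ht g
  have hv := hexp.comp (v := (spectralResolution A).integral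
    (fun x => Real.exp (-(t * x)) * besselSymbol r x) g) (measurable_besselSymbol r)
    (by convert hg using 1; ext; exact mul_comm _ _)
  rw [neg_neg, ← hg.inner_left (hE.hasIntegral_exp_mul_besselSymbol r ht h), ← hinner _ _ hv]
  refine hF.2 _ ⟨Lp.aestronglyMeasurable _, (hH t ht _ _ hexp).trans_lt ?_⟩
  exact ENNReal.mul_lt_top ENNReal.ofReal_lt_top enorm_lt_top

/-- `h` stands for `(I + A)^{γ/2} f`, for a function `f` in `H^γ(A)` and an order `γ` of either
sign: the operators `φ(A)` of order `-γ` act on `f` as `φ(A) (I + A)^{-γ/2}` on `h`. -/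
structure IsSobolevLift (A : Lp 𝕜 2 μ →ₗ.[𝕜] Lp 𝕜 2 μ) (γ : ℝ) (f : X → 𝕜) (h : Lp 𝕜 2 μ) :
    Prop where
  enorm_le : ‖h‖ₑ ≤ fnSobolevNorm A γ f
  represents : (spectralResolution A).Represents γ f h
  fnFuncCalc : ∀ (φ : ℝ → ℝ) (M : ℝ), Measurable φ →
    (∀ x, 0 < x → |φ x * besselSymbol (-γ) x| ≤ M) →
      FnFuncCalc A γ φ f ((spectralResolution A).integral (fun x => φ x * besselSymbol (-γ) x) h)

variable {γ : ℝ}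

theorem exists_isSobolevLift_of_nonneg (hE : (spectralResolution A).IsPositive) (hγ : 0 ≤ γ)
    (hf : fnSobolevNorm A γ f < ⊤) : ∃ h, IsSobolevLift A γ f h := by
  have hnorm : fnSobolevNorm A γ f = ⨅ hf₂ : MemLp f 2 μ, sobolevNorm A γ (hf₂.toLp f) := if_pos hγ
  obtain ⟨hf₂, hlt⟩ := iInf_lt_iff.1 (hnorm ▸ hf)
  obtain ⟨h, hlt⟩ := iInf_lt_iff.1 hlt
  obtain ⟨hh, -⟩ := iInf_lt_iff.1 hlt
  have hback := hE.hasIntegral_besselSymbol_neg hh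
  refine ⟨h, ?_, fun t ht g => ?_, fun φ M hφ hM => ⟨fun _ => ⟨hf₂, ?_⟩, fun hlt => ?_⟩⟩
  · rw [hnorm, iInf_pos hf₂]
    exact le_iInf₂ fun u hu => by rw [HasIntegral.unique hh hu]
  · have hu := hback.comp (ψ := fun x => Real.exp (-(t * x))) (by fun_prop)
      (hE.hasIntegral_exp_mul_besselSymbol (-γ) ht h)
    rw [← (hE.hasIntegral_exp ht g).inner_left hu, L2.inner_def]
    refine integral_congr_ae ?_
    filter_upwards [hf₂.coeFn_toLp] with x hx
    rw [hx]
  · exact hback.comp hφ (hE.hasIntegral_integral (by fun_prop) hM h)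
  · exact absurd hlt hγ.not_gt

theorem exists_isSobolevLift_of_neg (hE : (spectralResolution A).IsPositive)
    (hH : (spectralResolution A).HeatBound α C) (hγ : γ < 0) (hf : fnSobolevNorm A γ f < ⊤) :
    ∃ h, IsSobolevLift A γ f h := by
  set E := spectralResolution A
  have hγ' : 0 ≤ -γ := (neg_pos.2 hγ).le
  have hnorm : fnSobolevNorm A γ f =
      ⨅ (F : sobolevSpace A (-γ) →ₗ⋆[𝕜] 𝕜) (_ : IsDualElement A (-γ) f F), dualNorm A (-γ) F :=
    if_neg hγ.not_ge
  have hrep {F h} (hF : IsDualElement A (-γ) f F) (hin : ∀ v y,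
      (hv : E.HasIntegral (besselSymbol (-γ)) v y) → F ⟨v, hv.2.1⟩ = ⟪y, h⟫_𝕜) :
      E.Represents γ f h := neg_neg γ ▸ hF.represents hE hH hin
  obtain ⟨F, hlt⟩ := iInf_lt_iff.1 (hnorm ▸ hf)
  obtain ⟨hF, -⟩ := iInf_lt_iff.1 hlt
  obtain ⟨h, -, hinner⟩ := exists_inner_eq_of_dualNorm_lt_top hE hγ' hF.1
  refine ⟨h, ?_, hrep hF hinner, fun φ M hφ hM => ⟨fun hle => absurd hle hγ.not_ge,
    fun _ => ⟨F, hF, fun g => ?_⟩⟩⟩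
  · rw [hnorm]
    refine le_iInf₂ fun F' hF' => ?_
    obtain ⟨h', hle, hinner'⟩ := exists_inner_eq_of_dualNorm_lt_top hE hγ' hF'.1
    rwa [(hrep hF hinner).unique hE (hrep hF' hinner')]
  · have hbessel := hE.hasIntegral_integral (φ := fun x => φ x * besselSymbol (-γ) x)
      (by fun_prop) hM
    have hφM (x : ℝ) (hx : 0 < x) : |φ x| ≤ M := by
      refine le_trans ?_ (hM x hx)
      rw [abs_mul, abs_of_pos (besselSymbol_pos _ hx)]
      exact le_mul_of_one_le_right (abs_nonneg _)
        ((besselSymbol_zero x).symm.trans_le (besselSymbol_mono hγ' hx))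
    have hφg := hE.hasIntegral_integral hφ hφM g
    have hv := hφg.comp (v := E.integral (fun x => φ x * besselSymbol (-γ) x) g)
      (measurable_besselSymbol (-γ)) (by convert hbessel g using 1; ext; exact mul_comm _ _)
    exact ⟨⟨_, hv.2.1⟩, hφg, by rw [hinner _ _ hv, ← (hbessel g).inner_left (hbessel h)]⟩

theorem exists_isSobolevLift (hE : (spectralResolution A).IsPositive)
    (hH : (spectralResolution A).HeatBound α C) (hf : fnSobolevNorm A γ f < ⊤) :
    ∃ h, IsSobolevLift A γ f h :=
  (le_or_gt 0 γ).elim (exists_isSobolevLift_of_nonneg hE · hf)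
    (exists_isSobolevLift_of_neg hE hH · hf)

end Sobolev

section TimeDerivatives

variable {𝕜 H : Type*} [RCLike 𝕜] [NormedAddCommGroup H] [InnerProductSpace 𝕜 H] [CompleteSpace H]
  [NormedSpace ℝ H] [IsScalarTower ℝ 𝕜 H] {E : SpectralMeasure 𝕜 H}

namespace SpectralMeasure

theorem IsPositive.hasDerivAt_integral (hE : E.IsPositive) {Φ Φ' : ℝ → ℝ → ℝ}
    (hm : ∀ t, Measurable (Φ t)) (hm' : ∀ t, Measurable (Φ' t))
    (hb : ∀ δ, 0 < δ → ∃ M, ∀ t, δ ≤ t → ∀ x, 0 < x → |Φ t x| ≤ M)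
    (hb' : ∀ δ, 0 < δ → ∃ M, ∀ t, δ ≤ t → ∀ x, 0 < x → |Φ' t x| ≤ M)
    (hd : ∀ t, 0 < t → ∀ x, 0 < x → HasDerivAt (Φ · x) (Φ' t x) t) {t : ℝ} (ht : 0 < t) (h : H) :
    HasDerivAt (fun t => E.integral (Φ t) h) (E.integral (Φ' t) h) t := by
  obtain ⟨M, hM⟩ := hb (t / 2) (half_pos ht)
  obtain ⟨M', hM'⟩ := hb' (t / 2) (half_pos ht)
  have hball {τ : ℝ} (hτ : τ ∈ Metric.ball t (t / 2)) : t / 2 ≤ τ := by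
    rw [Metric.mem_ball, Real.dist_eq, abs_lt] at hτ
    linarith
  refine HasIntegral.hasDerivAt (half_pos ht)
    (fun τ hτ => hE.hasIntegral_integral (hm τ) (hM τ (hball hτ)) h)
    (hE.hasIntegral_integral (hm' t) (hM' t (by linarith)) h) (memLp_const M') ?_
  filter_upwards [hE.ae_pos h] with x hx τ hτ
  exact ⟨hd τ (by linarith [hball hτ]) x hx, hM' τ (hball hτ) x hx⟩

section Iterated

variable {Φ : ℕ → ℝ → ℝ → ℝ} {k j : ℕ} {t : ℝ}

theorem IsPositive.iteratedDeriv_integral (hE : E.IsPositive) (hm : ∀ j t, Measurable (Φ j t))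
    (hb : ∀ j ≤ k, ∀ δ, 0 < δ → ∃ M, ∀ t, δ ≤ t → ∀ x, 0 < x → |Φ j t x| ≤ M)
    (hd : ∀ j < k, ∀ t, 0 < t → ∀ x, 0 < x → HasDerivAt (Φ j · x) (Φ (j + 1) t x) t) (h : H)
    (hj : j ≤ k) (ht : 0 < t) :
    iteratedDeriv j (fun t => E.integral (Φ 0 t) h) t = E.integral (Φ j t) h := by
  induction j generalizing t with
  | zero => rw [iteratedDeriv_zero]
  | succ j ih =>
    have heq : iteratedDeriv j (fun t => E.integral (Φ 0 t) h) =ᶠ[𝓝 t]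
        fun t => E.integral (Φ j t) h :=
      (lt_mem_nhds ht).mono fun τ hτ => ih (by lia) hτ
    rw [iteratedDeriv_succ, heq.deriv_eq]
    exact (hE.hasDerivAt_integral (hm j) (hm (j + 1)) (hb j (by lia)) (hb (j + 1) hj)
      (hd j hj) ht h).deriv

theorem IsPositive.differentiableAt_iteratedDeriv_integral (hE : E.IsPositive)
    (hm : ∀ j t, Measurable (Φ j t))
    (hb : ∀ j ≤ k, ∀ δ, 0 < δ → ∃ M, ∀ t, δ ≤ t → ∀ x, 0 < x → |Φ j t x| ≤ M)
    (hd : ∀ j < k, ∀ t, 0 < t → ∀ x, 0 < x → HasDerivAt (Φ j · x) (Φ (j + 1) t x) t) (h : H)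
    (hj : j < k) (ht : 0 < t) :
    DifferentiableAt ℝ (iteratedDeriv j fun t => E.integral (Φ 0 t) h) t := by
  have heq : iteratedDeriv j (fun t => E.integral (Φ 0 t) h) =ᶠ[𝓝 t]
      fun t => E.integral (Φ j t) h :=
    (lt_mem_nhds ht).mono fun τ hτ => hE.iteratedDeriv_integral hm hb hd h hj.le hτ
  exact ((hE.hasDerivAt_integral (hm j) (hm (j + 1)) (hb j hj.le) (hb (j + 1) hj)
    (hd j hj) ht h).congr_of_eventuallyEq heq).differentiableAt

end Iterated

end SpectralMeasure

end TimeDerivatives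

section JapaneseBracket

variable {t ρ : ℝ}

theorem one_le_japaneseBracket (t : ℝ) : 1 ≤ japaneseBracket t :=
  Real.one_le_sqrt.2 (by nlinarith [sq_nonneg t])

theorem japaneseBracket_le (ht : 0 ≤ t) : japaneseBracket t ≤ 1 + t :=
  (Real.sqrt_le_left (by linarith)).2 (by nlinarith)

theorem one_add_rpow_neg_le (ht : 0 ≤ t) (hρ : 0 ≤ ρ) :
    (1 + t) ^ (-ρ) ≤ japaneseBracket t ^ (-ρ) :=
  Real.rpow_le_rpow_of_nonpos (zero_lt_one.trans_le (one_le_japaneseBracket t))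
    (japaneseBracket_le ht) (neg_nonpos.2 hρ)

theorem exists_exp_neg_le_japaneseBracket {c : ℝ} (hc : 1 / 4 < c) (hρ : 0 ≤ ρ) :
    ∃ K : ℝ, 0 < K ∧ ∀ t : ℝ, 0 ≤ t →
      Real.exp (-(c * t)) ≤ K * japaneseBracket t ^ (-ρ) * Real.exp (-t / 4) := by
  obtain ⟨K, hK, hpow⟩ := exists_rpow_le_mul_exp hρ (sub_pos.2 hc)
  refine ⟨K * Real.exp (c - 1 / 4), by positivity, fun t ht => ?_⟩
  have hexp : Real.exp (-((c - 1 / 4) * (1 + t))) ≤ K * (1 + t) ^ (-ρ) := by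
    rw [Real.exp_neg, Real.rpow_neg (by linarith), ← div_eq_mul_inv, inv_le_comm₀ (by positivity)
      (by positivity), inv_div, div_le_iff₀ hK, mul_comm]
    exact hpow (1 + t) (by linarith)
  calc Real.exp (-(c * t))
      = Real.exp (c - 1 / 4) * Real.exp (-((c - 1 / 4) * (1 + t))) * Real.exp (-t / 4) := by
        rw [← Real.exp_add, ← Real.exp_add]; congr 1; ring
    _ ≤ Real.exp (c - 1 / 4) * (K * (1 + t) ^ (-ρ)) * Real.exp (-t / 4) := by gcongr
    _ ≤ Real.exp (c - 1 / 4) * (K * japaneseBracket t ^ (-ρ)) * Real.exp (-t / 4) := by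
        have hle := one_add_rpow_neg_le ht hρ
        gcongr
    _ = K * Real.exp (c - 1 / 4) * japaneseBracket t ^ (-ρ) * Real.exp (-t / 4) := by ring

end JapaneseBracket

section Smoothing

open SpectralMeasure

variable {X 𝕜 : Type*} [RCLike 𝕜] [MeasurableSpace X] {μ : Measure X}
  {E : SpectralMeasure 𝕜 (Lp 𝕜 2 μ)} {α C γ q : ℝ}

namespace SpectralMeasure

/-- The smoothing of the heat semigroup from `L^q` to `L^p`: `‖ψ(A) f‖_{L^p} ≤ K M t^{-κ} ‖f‖_{L^q}`
for `A = ∫ λ dE(λ)` and all symbols with `|ψ(λ)| ≤ M e^{-tλ}`. Here `f` need not be in `L²`: it is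
given by `h = (I + A)^{γ/2} f`. -/
def HeatSmoothing (E : SpectralMeasure 𝕜 (Lp 𝕜 2 μ)) (γ κ K : ℝ) (q p : ℝ≥0∞) : Prop :=
  ∀ (f : X → 𝕜) (h u : Lp 𝕜 2 μ) (ψ : ℝ → ℝ) (M t : ℝ), AEStronglyMeasurable f μ →
    E.Represents γ f h → 0 < t → 0 ≤ M → (∀ x, 0 < x → |ψ x| ≤ M * Real.exp (-(t * x))) →
    Measurable ψ → E.HasIntegral (fun x => ψ x * besselSymbol (-γ) x) h u →
    eLpNorm u p μ ≤ ENNReal.ofReal (K * M * t ^ (-κ)) * eLpNorm f q μ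

theorem IsPositive.heatSmoothing_two (hC : 0 < C) (hE : E.IsPositive) (hH : E.HeatBound α C)
    (hq : 1 ≤ q) (hq' : q ≤ 2) :
    E.HeatSmoothing γ (2 * α * (1 / q - 1 / 2)) (C ^ (2 / q - 1)) (ENNReal.ofReal q) 2 := by
  intro f h u ψ M t hf hh ht hM hψ _ hu
  have hθ : 0 ≤ 2 / q - 1 := sub_nonneg.2 ((one_le_div (by linarith)).2 hq')
  have hle : ‖u‖ₑ ≤ ENNReal.ofReal M *
      ‖E.integral (fun x => Real.exp (-(t * x)) * besselSymbol (-γ) x) h‖ₑ :=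
    hE.enorm_le hu (hE.hasIntegral_exp_mul_besselSymbol (-γ) ht h) fun x hx => by
      rw [abs_mul, abs_mul, Real.abs_exp, ← mul_assoc]
      exact mul_le_mul_of_nonneg_right (hψ x hx) (abs_nonneg _)
  rw [← Lp.enorm_def]
  refine (hle.trans (mul_le_mul_right (hh.enorm_integral_exp_le hE hH hq hq' hf ht) _)).trans_eq ?_
  rw [ENNReal.ofReal_rpow_of_nonneg (by positivity) hθ, ← mul_assoc, ← ENNReal.ofReal_mul hM,
    Real.mul_rpow hC.le (by positivity), ← Real.rpow_mul ht.le]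
  ring_nf

/-- Half of the time is spent on `L^q → L²` and half on `L² → L^∞`. -/
theorem IsPositive.heatSmoothing_top (hC : 0 < C) (hE : E.IsPositive) (hH : E.HeatBound α C)
    (hq : 1 ≤ q) (hq' : q ≤ 2) :
    E.HeatSmoothing γ (2 * α / q) (C ^ (2 / q) * 2 ^ (2 * α / q)) (ENNReal.ofReal q) ⊤ := by
  intro f h u ψ M t hf hh ht hM hψ hm hu
  have hθ : 0 ≤ 2 / q - 1 := sub_nonneg.2 ((one_le_div (by linarith)).2 hq')
  have ht' : 0 < t / 2 := half_pos ht
  have hy := hE.hasIntegral_exp_mul_besselSymbol (-γ) ht' h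
  set y := E.integral (fun x => Real.exp (-(t / 2 * x)) * besselSymbol (-γ) x) h
  have huy : E.HasIntegral (fun x => Real.exp (t / 2 * x) * ψ x) y u := by
    refine hy.comp (by fun_prop) ?_
    convert hu using 1
    ext x
    rw [Pi.mul_apply, mul_mul_mul_comm, ← Real.exp_add, add_neg_cancel, Real.exp_zero, one_mul]
  have htop := hH.eLpNorm_top_le ht' huy (M := M) <| (hE.ae_pos y).mono fun x hx => by
    rw [abs_mul, abs_mul, Real.abs_exp, ← mul_assoc, ← Real.exp_add]
    refine (mul_le_mul_of_nonneg_left (hψ x hx) (Real.exp_nonneg _)).trans_eq ?_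
    rw [mul_left_comm, ← Real.exp_add, ← add_mul, add_halves, add_neg_cancel, Real.exp_zero,
      mul_one]
  refine (htop.trans (mul_le_mul_right (mul_le_mul_right
    (hh.enorm_integral_exp_le hE hH hq hq' hf ht') _) _)).trans_eq ?_
  have hpow : C * (t / 2) ^ (-α) * (C * (t / 2) ^ (-α)) ^ (2 / q - 1) =
      C ^ (2 / q) * 2 ^ (2 * α / q) * t ^ (-(2 * α / q)) := by
    have hrpow : C * (t / 2) ^ (-α) * (C * (t / 2) ^ (-α)) ^ (2 / q - 1) =
        (C * (t / 2) ^ (-α)) ^ (2 / q) := by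
      rw [Real.rpow_sub_one (by positivity)]
      field_simp
    rw [hrpow, Real.mul_rpow hC.le (by positivity), ← Real.rpow_mul ht'.le,
      Real.div_rpow ht.le zero_le_two, ← neg_mul_eq_neg_mul, Real.rpow_neg zero_le_two,
      div_inv_eq_mul]
    ring_nf
  rw [ENNReal.ofReal_rpow_of_nonneg (by positivity) hθ, ← mul_assoc, ← mul_assoc,
    ← ENNReal.ofReal_mul (by positivity), ← ENNReal.ofReal_mul (by positivity), mul_right_comm,
    hpow]
  ring_nf

end SpectralMeasure

/-- Bounds for a family of symbols `m 0 t` with time derivatives `m j t`, `j ≤ k`: these are symbols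
of order `γ₀`, locally uniformly in `t > 0`, and `m k t` is the sum of a high-frequency part `hi t`
of order `γ₀`, decaying faster than `e^{-t/4}`, and of a remainder that decays like `t^{-ρ₀}` times
the symbol of the heat semigroup. -/
structure SymbolBounds (m : ℕ → ℝ → ℝ → ℝ) (hi : ℝ → ℝ → ℝ) (k : ℕ) (T : Set ℝ) (γ₀ ρ₀ : ℝ) :
    Prop where
  pos_of_mem : ∀ t ∈ T, 0 < t
  measurable : ∀ j t, Measurable (m j t)
  measurable_hi : ∀ t, Measurable (hi t)
  hasDerivAt : ∀ j < k, ∀ t, 0 < t → ∀ x, 0 < x → HasDerivAt (m j · x) (m (j + 1) t x) t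
  exists_bound : ∀ j ≤ k, ∀ δ, 0 < δ → ∃ M, ∀ t, δ ≤ t → ∀ x, 0 < x →
    |m j t x| ≤ M * besselSymbol γ₀ x
  exists_low_bound : ∃ M c, 0 < M ∧ 0 < c ∧ ∀ t ∈ T, ∀ x, 0 < x →
    |m k t x - hi t x| ≤ M * (1 + t) ^ (-ρ₀) * Real.exp (-(c * (1 + t) * x))
  exists_high_bound : ∃ M c, 0 < M ∧ 1 / 4 < c ∧ ∀ t ∈ T, ∀ x, 0 < x →
    |hi t x| ≤ M * Real.exp (-(c * t)) * besselSymbol γ₀ x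

theorem abs_mul_besselSymbol_neg_le {φ : ℝ → ℝ} {γ γ₀ M x : ℝ} (hx : 0 < x)
    (hM : |φ x| ≤ M * besselSymbol γ₀ x) :
    |φ x * besselSymbol (-γ) x| ≤ M * besselSymbol (-(γ - γ₀)) x := by
  rw [abs_mul, abs_of_pos (besselSymbol_pos _ hx), neg_sub, sub_eq_add_neg,
    ← besselSymbol_mul _ _ hx, ← mul_assoc]
  exact mul_le_mul_of_nonneg_right hM (besselSymbol_pos _ hx).le

theorem abs_mul_besselSymbol_neg_le_of_le {φ : ℝ → ℝ} {γ γ₀ M x : ℝ} (hγ : γ₀ ≤ γ) (hx : 0 < x)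
    (hM : |φ x| ≤ M * besselSymbol γ₀ x) : |φ x * besselSymbol (-γ) x| ≤ M :=
  (abs_mul_besselSymbol_neg_le hx hM).trans <| mul_le_of_le_one_right
    (nonneg_of_mul_nonneg_left ((abs_nonneg _).trans hM) (besselSymbol_pos _ hx))
    (besselSymbol_le_one (by linarith) hx)

theorem eLpNorm_le_eLpNorm_sub_add {p : ℝ≥0∞} (hp : 1 ≤ p) (u v : Lp 𝕜 2 μ) :
    eLpNorm u p μ ≤ eLpNorm (u - v : Lp 𝕜 2 μ) p μ + eLpNorm v p μ := by
  conv_lhs => rw [← sub_add_cancel u v, eLpNorm_congr_ae (Lp.coeFn_add (u - v) v)]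
  exact eLpNorm_add_le (Lp.aestronglyMeasurable _) (Lp.aestronglyMeasurable _) hp

theorem HeatDecay.exists_heatBound {A : Lp 𝕜 2 μ →ₗ.[𝕜] Lp 𝕜 2 μ} (hA : HeatDecay A α) :
    ∃ C : ℝ, 0 < C ∧ (spectralResolution A).HeatBound α C := by
  simpa only [HeatDecay, FuncCalc, HeatBound, Lp.enorm_def] using hA

namespace SymbolBounds

variable {A : Lp 𝕜 2 μ →ₗ.[𝕜] Lp 𝕜 2 μ} {m : ℕ → ℝ → ℝ → ℝ} {hi : ℝ → ℝ → ℝ} {k : ℕ} {T : Set ℝ}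
  {γ₀ ρ₀ κ K : ℝ} {p r : ℝ≥0∞}

theorem exists_eLpNorm_low_le (hS : SymbolBounds m hi k T γ₀ ρ₀) (hρ : 0 ≤ κ + ρ₀) (hK : 0 < K)
    (hlow : E.HeatSmoothing γ κ K r p) :
    ∃ B : ℝ, 0 < B ∧ ∀ f h u, AEStronglyMeasurable f μ → E.Represents γ f h → ∀ t ∈ T,
      E.HasIntegral (fun x => (m k t x - hi t x) * besselSymbol (-γ) x) h u →
      eLpNorm u p μ ≤ ENNReal.ofReal (B * japaneseBracket t ^ (-(κ + ρ₀))) * eLpNorm f r μ := by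
  obtain ⟨M, c, hM, hc, hbound⟩ := hS.exists_low_bound
  refine ⟨K * M * c ^ (-κ), by positivity, fun f h u hf hh t htT hu => ?_⟩
  have ht := hS.pos_of_mem t htT
  refine (hlow f h u _ _ (c * (1 + t)) hf hh (by positivity) (by positivity) (hbound t htT)
    ((hS.measurable k t).sub (hS.measurable_hi t)) hu).trans ?_
  refine mul_le_mul_left (ENNReal.ofReal_le_ofReal ?_) _
  calc K * (M * (1 + t) ^ (-ρ₀)) * (c * (1 + t)) ^ (-κ)
      = K * M * c ^ (-κ) * (1 + t) ^ (-(κ + ρ₀)) := by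
        rw [Real.mul_rpow hc.le (by positivity), neg_add, Real.rpow_add (by positivity)]
        ring
    _ ≤ K * M * c ^ (-κ) * japaneseBracket t ^ (-(κ + ρ₀)) := by
        have hle := one_add_rpow_neg_le ht.le hρ
        gcongr

theorem exists_eLpNorm_high_le {ρ : ℝ} (hS : SymbolBounds m hi k T γ₀ ρ₀) (hρ : 0 ≤ ρ) (hK : 0 < K)
    (hhigh : E.SobolevEmbedding (γ - γ₀) K p) :
    ∃ B : ℝ, 0 < B ∧ ∀ h u, ∀ t ∈ T, E.HasIntegral (fun x => hi t x * besselSymbol (-γ) x) h u →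
      eLpNorm u p μ ≤ ENNReal.ofReal (B * japaneseBracket t ^ (-ρ)) *
        (ENNReal.ofReal (Real.exp (-t / 4)) * ‖h‖ₑ) := by
  obtain ⟨M, c, hM, hc, hbound⟩ := hS.exists_high_bound
  obtain ⟨B, hB, hexp⟩ := exists_exp_neg_le_japaneseBracket hc hρ
  refine ⟨K * M * B, by positivity, fun h u t htT hu => ?_⟩
  have hJ : 0 < japaneseBracket t := zero_lt_one.trans_le (one_le_japaneseBracket t)
  refine (hhigh _ h u (M * Real.exp (-(c * t))) (by positivity)
    (fun x hx => abs_mul_besselSymbol_neg_le hx (hbound t htT x hx)) hu).trans ?_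
  rw [← mul_assoc _ _ ‖h‖ₑ, ← ENNReal.ofReal_mul (by positivity)]
  refine mul_le_mul_left (ENNReal.ofReal_le_ofReal ?_) _
  calc K * (M * Real.exp (-(c * t)))
      ≤ K * (M * (B * japaneseBracket t ^ (-ρ) * Real.exp (-t / 4))) := by
        gcongr
        exact hexp t (hS.pos_of_mem t htT).le
    _ = K * M * B * japaneseBracket t ^ (-ρ) * Real.exp (-t / 4) := by ring

/-- The remainder is estimated by the smoothing of the heat semigroup applied to `f ∈ L^q`, the
high-frequency part by the Sobolev embedding. -/
theorem decayEstimate (hS : SymbolBounds m hi k T γ₀ ρ₀) (hE : (spectralResolution A).IsPositive)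
    (hH : (spectralResolution A).HeatBound α C) (hγ : γ₀ ≤ γ) (hρ : 0 ≤ κ + ρ₀) (hp : 1 ≤ p)
    (hlow : ∃ K, 0 < K ∧ (spectralResolution A).HeatSmoothing γ κ K r p)
    (hhigh : ∃ K, 0 < K ∧ (spectralResolution A).SobolevEmbedding (γ - γ₀) K p) :
    DecayEstimate A (m 0) k p r γ (κ + ρ₀) T := by
  obtain ⟨K, hK, hlow⟩ := hlow
  obtain ⟨K', hK', hhigh⟩ := hhigh
  obtain ⟨B, hB, hlow⟩ := hS.exists_eLpNorm_low_le hρ hK hlow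
  obtain ⟨B', hB', hhigh⟩ := hS.exists_eLpNorm_high_le hρ hK' hhigh
  refine ⟨B + B', by positivity, fun f hf hfγ => ?_⟩
  obtain ⟨h, hh⟩ := exists_isSobolevLift hE hH hfγ
  have hm (j : ℕ) (t : ℝ) : Measurable fun x => m j t x * besselSymbol (-γ) x :=
    (hS.measurable j t).mul (measurable_besselSymbol _)
  have hb (j : ℕ) (hj : j ≤ k) (δ : ℝ) (hδ : 0 < δ) :
      ∃ M, ∀ t, δ ≤ t → ∀ x, 0 < x → |m j t x * besselSymbol (-γ) x| ≤ M :=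
    (hS.exists_bound j hj δ hδ).imp fun M hM t ht x hx =>
      abs_mul_besselSymbol_neg_le_of_le hγ hx (hM t ht x hx)
  have hd (j : ℕ) (hj : j < k) (t : ℝ) (ht : 0 < t) (x : ℝ) (hx : 0 < x) :=
    (hS.hasDerivAt j hj t ht x hx).mul_const (besselSymbol (-γ) x)
  refine ⟨fun t => (spectralResolution A).integral (fun x => m 0 t x * besselSymbol (-γ) x) h,
    fun t ht => ?_, fun t htT => ?_⟩
  · obtain ⟨M, hM⟩ := hb 0 k.zero_le t ht
    exact hh.fnFuncCalc _ M (hS.measurable 0 t) (hM t le_rfl)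
  have ht := hS.pos_of_mem t htT
  refine ⟨fun j hj => hE.differentiableAt_iteratedDeriv_integral hm hb hd h hj ht, ?_⟩
  rw [hE.iteratedDeriv_integral hm hb hd h le_rfl ht]
  obtain ⟨M, hM⟩ := hb k le_rfl t ht
  obtain ⟨M', c, -, -, hM'⟩ := hS.exists_high_bound
  have hu := hE.hasIntegral_integral (hm k t) (hM t le_rfl) h
  have hv := hE.hasIntegral_integral ((hS.measurable_hi t).mul (measurable_besselSymbol (-γ)))
    (fun x hx => abs_mul_besselSymbol_neg_le_of_le hγ hx (hM' t htT x hx)) h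
  have hJ : 0 < japaneseBracket t := zero_lt_one.trans_le (one_le_japaneseBracket t)
  refine (eLpNorm_le_eLpNorm_sub_add hp _ _).trans ((add_le_add
    (hlow f h _ hf.aestronglyMeasurable hh.represents t htT ?_) (hhigh h _ t htT hv)).trans ?_)
  · convert hu.sub hv using 1
    exact funext fun x => sub_mul _ _ _
  · rw [mul_add]
    gcongr
    · exact le_add_of_nonneg_right hB'.le
    · exact le_add_of_nonneg_left hB.le
    · exact hh.enorm_le

theorem decayEstimate_two (hS : SymbolBounds m hi k T γ ρ₀) (hρ₀ : 0 ≤ ρ₀) (hα : 0 < α)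
    (hA : HeatDecay A α) (hq : 1 ≤ q) (hq' : q ≤ 2) :
    DecayEstimate A (m 0) k 2 (ENNReal.ofReal q) γ (2 * α * (1 / q - 1 / 2) + ρ₀) T := by
  obtain ⟨C, hC, hH⟩ := hA.exists_heatBound
  have hE := hH.isPositive hα
  have hκ : 0 ≤ 1 / q - 1 / 2 :=
    sub_nonneg.2 (one_div_le_one_div_of_le (zero_lt_one.trans_le hq) hq')
  refine hS.decayEstimate hE hH le_rfl (by positivity) one_le_two
    ⟨_, by positivity, hE.heatSmoothing_two hC hH hq hq'⟩ ⟨1, one_pos, ?_⟩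
  intro ψ h u M _ hψ hu
  rw [one_mul, ← Lp.enorm_def]
  exact hE.enorm_le hu (hasIntegral_one h) (by simpa [besselSymbol_zero] using hψ)

theorem decayEstimate_top (hS : SymbolBounds m hi k T γ₀ ρ₀) (hρ₀ : 0 ≤ ρ₀) (hα : 0 < α)
    (hA : HeatDecay A α) (hq : 1 ≤ q) (hq' : q ≤ 2) {β : ℝ} (hβ : 2 * α + γ₀ < β) :
    DecayEstimate A (m 0) k ⊤ (ENNReal.ofReal q) β (2 * α / q + ρ₀) T := by
  obtain ⟨C, hC, hH⟩ := hA.exists_heatBound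
  have hE := hH.isPositive hα
  exact hS.decayEstimate hE hH (by linarith) (by positivity) le_top
    ⟨_, by positivity, hE.heatSmoothing_top hC hH hq hq'⟩
    (hH.exists_sobolevEmbedding hC hE (by linarith) (by linarith))

end SymbolBounds

end Smoothing

section DampedSymbol

/-- The companion of `dampedSymbol` with `cosh`, `cos` in place of `sinh`, `sin`, so that
`∂_t 𝒟 = dampedCosine - 𝒟 / 2`. -/
def dampedCosine (t x : ℝ) : ℝ :=
  Real.exp (-t / 2) * (if x < 1 / 4 then Real.cosh (t * Real.sqrt (1 / 4 - x))
    else if x = 1 / 4 then 1 else Real.cos (t * Real.sqrt (x - 1 / 4)))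

/-- The time derivative of order `k` of `𝒟(t, x)`; from the second order on it is read off the
damped wave equation `∂_t² 𝒟 + ∂_t 𝒟 + x 𝒟 = 0`. -/
def dampedDeriv : ℕ → ℝ → ℝ → ℝ
  | 0, t, x => dampedSymbol t x
  | 1, t, x => dampedCosine t x - dampedSymbol t x / 2
  | k + 2, t, x => -dampedDeriv (k + 1) t x - x * dampedDeriv k t x

@[fun_prop]
theorem measurable_dampedSymbol (t : ℝ) : Measurable (dampedSymbol t) := by
  unfold dampedSymbol
  exact .ite measurableSet_Iio (by fun_prop)
    (.ite (measurableSet_singleton _) (by fun_prop) (by fun_prop))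

@[fun_prop]
theorem measurable_dampedCosine (t : ℝ) : Measurable (dampedCosine t) := by
  unfold dampedCosine
  exact .const_mul (.ite measurableSet_Iio (by fun_prop)
    (.ite (measurableSet_singleton _) (by fun_prop) (by fun_prop))) _

@[fun_prop]
theorem measurable_dampedDeriv (k : ℕ) (t : ℝ) : Measurable (dampedDeriv k t) := by
  induction k using Nat.twoStepInduction with
  | zero => exact measurable_dampedSymbol t
  | one => exact (measurable_dampedCosine t).sub ((measurable_dampedSymbol t).div_const 2)
  | more k h₀ h₁ => exact h₁.neg.sub (measurable_id.mul h₀)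

theorem hasDerivAt_exp_neg_div_two (t : ℝ) :
    HasDerivAt (fun t : ℝ => Real.exp (-t / 2)) (Real.exp (-t / 2) * (-1 / 2)) t :=
  ((hasDerivAt_id t).neg.div_const 2).exp

theorem hasDerivAt_dampedSymbol (t x : ℝ) :
    HasDerivAt (dampedSymbol · x) (dampedCosine t x - dampedSymbol t x / 2) t := by
  have hexp := hasDerivAt_exp_neg_div_two t
  unfold dampedCosine dampedSymbol
  split_ifs with hlt heq
  · have hr : Real.sqrt (1 / 4 - x) ≠ 0 := (Real.sqrt_pos.2 (by linarith)).ne'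
    refine ((hexp.mul (hasDerivAt_mul_const _).sinh).div_const _).congr_deriv ?_
    generalize Real.sqrt (1 / 4 - x) = r at hr ⊢
    field_simp
    ring
  · refine ((hasDerivAt_id t).mul hexp).congr_deriv ?_
    simp only [id_eq]
    ring
  · have hr : Real.sqrt (x - 1 / 4) ≠ 0 :=
      (Real.sqrt_pos.2 (sub_pos.2 ((not_lt.1 hlt).lt_of_ne' heq))).ne'
    refine ((hexp.mul (hasDerivAt_mul_const _).sin).div_const _).congr_deriv ?_
    generalize Real.sqrt (x - 1 / 4) = r at hr ⊢
    field_simp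
    ring

theorem hasDerivAt_dampedCosine (t x : ℝ) :
    HasDerivAt (dampedCosine · x) ((1 / 4 - x) * dampedSymbol t x - dampedCosine t x / 2) t := by
  have hexp := hasDerivAt_exp_neg_div_two t
  unfold dampedCosine dampedSymbol
  split_ifs with hlt heq
  · have hr : Real.sqrt (1 / 4 - x) ≠ 0 := (Real.sqrt_pos.2 (by linarith)).ne'
    have hr2 : Real.sqrt (1 / 4 - x) ^ 2 = 1 / 4 - x := Real.sq_sqrt (by linarith)
    refine (hexp.mul (hasDerivAt_mul_const _).cosh).congr_deriv ?_
    generalize Real.sqrt (1 / 4 - x) = r at hr hr2 ⊢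
    rw [← hr2]
    field_simp
    ring
  · refine (hexp.mul_const 1).congr_deriv ?_
    rw [heq]
    ring
  · have hx : 0 < x - 1 / 4 := sub_pos.2 ((not_lt.1 hlt).lt_of_ne' heq)
    have hr : Real.sqrt (x - 1 / 4) ≠ 0 := (Real.sqrt_pos.2 hx).ne'
    have hr2 : Real.sqrt (x - 1 / 4) ^ 2 = x - 1 / 4 := Real.sq_sqrt hx.le
    refine (hexp.mul (hasDerivAt_mul_const _).cos).congr_deriv ?_
    generalize Real.sqrt (x - 1 / 4) = r at hr hr2 ⊢
    rw [← neg_sub x, ← hr2]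
    field_simp
    ring

theorem hasDerivAt_dampedDeriv (k : ℕ) (t x : ℝ) :
    HasDerivAt (dampedDeriv k · x) (dampedDeriv (k + 1) t x) t := by
  induction k using Nat.twoStepInduction with
  | zero => exact hasDerivAt_dampedSymbol t x
  | one =>
    refine ((hasDerivAt_dampedCosine t x).sub
      ((hasDerivAt_dampedSymbol t x).div_const 2)).congr_deriv ?_
    simp only [dampedDeriv]
    ring
  | more k h₀ h₁ => exact h₁.neg.sub (h₀.const_mul x)

/-- The time derivative of order `k` of `e^{-tx}`. -/
def heatDeriv (k : ℕ) (t x : ℝ) : ℝ := (-x) ^ k * Real.exp (-(t * x))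

@[fun_prop]
theorem measurable_heatDeriv (k : ℕ) (t : ℝ) : Measurable (heatDeriv k t) := by
  unfold heatDeriv
  fun_prop

theorem hasDerivAt_heatDeriv (k : ℕ) (t x : ℝ) :
    HasDerivAt (heatDeriv k · x) (heatDeriv (k + 1) t x) t := by
  refine ((hasDerivAt_mul_const x).fun_neg.exp.const_mul ((-x) ^ k)).congr_deriv ?_
  simp only [heatDeriv]
  ring

end DampedSymbol

section LowFrequency

variable {t x : ℝ}

/-- The modes are `e^{-tp}` and `e^{-t(1-p)}` with `-p`, `-(1 - p)` the roots of `r² + r + x = 0`,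
equal to `-3/10` and `-7/10` at `x = 21/100`. The slow mode is close to `e^{-tx}` as
`p = x + p²`. -/
theorem exists_dampedDeriv_eq (hx : 0 < x) (hx' : x ≤ 21 / 100) :
    ∃ p : ℝ, 0 < p ∧ p ≤ 3 / 10 ∧ p * (1 - p) = x ∧ ∀ k t, dampedDeriv k t x =
      ((-p) ^ k * Real.exp (-(t * p)) - (-(1 - p)) ^ k * Real.exp (-(t * (1 - p)))) /
        (1 - 2 * p) := by
  set r := Real.sqrt (1 / 4 - x) with hr
  have hr2 : r ^ 2 = 1 / 4 - x := Real.sq_sqrt (by linarith)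
  have hr_ge : 1 / 5 ≤ r := Real.le_sqrt_of_sq_le (by linarith)
  have hr_lt : r < 1 / 2 := by nlinarith
  have hslow (t : ℝ) : Real.exp (-t / 2) * Real.exp (t * r) = Real.exp (-(t * (1 / 2 - r))) := by
    rw [← Real.exp_add]; congr 1; ring
  have hfast (t : ℝ) :
      Real.exp (-t / 2) * Real.exp (-(t * r)) = Real.exp (-(t * (1 - (1 / 2 - r)))) := by
    rw [← Real.exp_add]; congr 1; ring
  have hden : 1 - 2 * (1 / 2 - r) = 2 * r := by ring
  refine ⟨1 / 2 - r, by linarith, by linarith, by linarith, fun k t => ?_⟩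
  rw [← hslow, ← hfast, hden]
  induction k using Nat.twoStepInduction with
  | zero =>
    rw [dampedDeriv, dampedSymbol, if_pos (by linarith), ← hr, Real.sinh_eq]
    field_simp
  | one =>
    rw [dampedDeriv, dampedSymbol, dampedCosine, if_pos (by linarith), if_pos (by linarith), ← hr,
      Real.sinh_eq, Real.cosh_eq]
    field_simp
    ring
  | more k h₀ h₁ =>
    rw [dampedDeriv, h₀, h₁, show x = (1 / 2 - r) * (1 - (1 / 2 - r)) by linarith]
    ring

theorem exp_sub_exp_le {p : ℝ} (ht : 0 < t) (hp : 0 < p) (hp' : p ≤ 3 / 10) :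
    Real.exp (-(t * (p * (1 - p)))) - Real.exp (-(t * p)) ≤
      3 * p * Real.exp (-(t * (p * (1 - p)) / 2)) := by
  set G := Real.exp (-(t * (p * (1 - p)) / 2))
  have hsq : Real.exp (-(t * (p * (1 - p)))) = G * G := by
    rw [← Real.exp_add]; congr 1; ring
  have hshift : Real.exp (-(t * p)) = G * G * Real.exp (-(t * p ^ 2)) := by
    rw [← Real.exp_add, ← Real.exp_add]; congr 1; ring
  have hinv : G * Real.exp (t * (p * (1 - p)) / 2) = 1 := by
    rw [← Real.exp_add, neg_add_cancel, Real.exp_zero]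
  have hG : 0 < G := Real.exp_pos _
  have hGle : t * (p * (1 - p)) / 2 * G ≤ 1 := by
    nlinarith [Real.add_one_le_exp (t * (p * (1 - p)) / 2)]
  calc Real.exp (-(t * (p * (1 - p)))) - Real.exp (-(t * p))
      = G * G * (1 - Real.exp (-(t * p ^ 2))) := by rw [hsq, hshift]; ring
    _ ≤ G * G * (t * p ^ 2) := by gcongr; linarith [Real.add_one_le_exp (-(t * p ^ 2))]
    _ ≤ G * G * (t * p ^ 2 * (3 / 2 * (1 - p))) := by
        exact mul_le_mul_of_nonneg_left (le_mul_of_one_le_right (by positivity) (by linarith))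
          (by positivity)
    _ = 3 * p * G * (t * (p * (1 - p)) / 2 * G) := by ring
    _ ≤ 3 * p * G := mul_le_of_le_one_right (by positivity) hGle

theorem abs_slowMode_sub_heatDeriv_le (k : ℕ) {p : ℝ} (ht : 0 < t) (hp : 0 < p)
    (hp' : p ≤ 3 / 10) :
    |(-p) ^ k * Real.exp (-(t * p)) / (1 - 2 * p) - heatDeriv k t (p * (1 - p))| ≤
      (8 + k) * p ^ (k + 1) * Real.exp (-(t * (p * (1 - p)) / 2)) := by
  have hsub := exp_sub_exp_le ht hp hp'
  set E := Real.exp (-(t * p))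
  set F := Real.exp (-(t * (p * (1 - p)))) with hF
  set G := Real.exp (-(t * (p * (1 - p)) / 2))
  have hpp : 0 < t * p := mul_pos ht hp
  have hE : 0 < E := Real.exp_pos _
  have hEF : E ≤ F := Real.exp_le_exp.2 (by nlinarith)
  have hEG : E ≤ G := Real.exp_le_exp.2 (by nlinarith)
  have hpow : (1 - p) ^ k ≤ 1 := pow_le_one₀ (by linarith) (by linarith)
  have hpow₀ : 0 ≤ (1 - p) ^ k := pow_nonneg (by linarith) k
  have hbernoulli : 1 - (1 - p) ^ k ≤ k * p := by
    have := one_add_mul_le_pow (a := -p) (by linarith) k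
    rw [← sub_eq_add_neg] at this
    linarith
  have hinv : (1 - 2 * p)⁻¹ ≤ 5 / 2 := inv_le_of_inv_le₀ (by norm_num) (by linarith)
  have hinv₀ : 0 < (1 - 2 * p)⁻¹ := inv_pos.2 (by linarith)
  have hsplit : (-p) ^ k * E / (1 - 2 * p) - heatDeriv k t (p * (1 - p)) = (-p) ^ k *
      (2 * p * (1 - 2 * p)⁻¹ * E + (1 - (1 - p) ^ k) * E - (1 - p) ^ k * (F - E)) := by
    have hcancel : (1 - 2 * p)⁻¹ * (1 - 2 * p) = 1 := inv_mul_cancel₀ (by linarith)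
    rw [heatDeriv, ← hF, ← neg_mul, mul_pow, div_eq_mul_inv]
    linear_combination (-p) ^ k * E * hcancel
  have h₁ : 2 * p * (1 - 2 * p)⁻¹ * E ≤ 2 * p * (5 / 2) * G := by gcongr
  have h₂ : (1 - (1 - p) ^ k) * E ≤ k * p * G := by gcongr
  have h₃ : (1 - p) ^ k * (F - E) ≤ 1 * (3 * p * G) := by gcongr
  have h₁' : 0 ≤ 2 * p * (1 - 2 * p)⁻¹ * E := by positivity
  have h₂' : 0 ≤ (1 - (1 - p) ^ k) * E := mul_nonneg (by linarith) hE.le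
  have h₃' : 0 ≤ (1 - p) ^ k * (F - E) := mul_nonneg hpow₀ (by linarith)
  rw [hsplit, abs_mul, abs_pow, abs_neg, abs_of_pos hp]
  calc p ^ k * |2 * p * (1 - 2 * p)⁻¹ * E + (1 - (1 - p) ^ k) * E - (1 - p) ^ k * (F - E)|
      ≤ p ^ k * ((8 + k) * p * G) := by gcongr; rw [abs_le]; constructor <;> linarith
    _ = _ := by ring

theorem abs_dampedDeriv_sub_heatDeriv_le (k : ℕ) (ht : 0 < t) (hx : 0 < x) (hx' : x ≤ 21 / 100) :
    |dampedDeriv k t x - heatDeriv k t x| ≤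
      (8 + k) * 2 ^ (k + 1) * (x ^ (k + 1) * Real.exp (-(t * x / 2)) + Real.exp (-(t / 2))) := by
  obtain ⟨p, hp, hp', rfl, hD⟩ := exists_dampedDeriv_eq hx hx'
  have hslow := abs_slowMode_sub_heatDeriv_le k ht hp hp'
  have hfast : |(-(1 - p)) ^ k * Real.exp (-(t * (1 - p))) / (1 - 2 * p)| ≤
      5 / 2 * Real.exp (-(t / 2)) := by
    rw [abs_div, abs_mul, abs_pow, abs_neg, Real.abs_exp, abs_of_pos (by linarith : 0 < 1 - p),
      abs_of_pos (by linarith : 0 < 1 - 2 * p), div_le_iff₀ (by linarith)]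
    calc (1 - p) ^ k * Real.exp (-(t * (1 - p))) ≤ 1 * Real.exp (-(t / 2)) := by
          gcongr
          · exact pow_le_one₀ (by linarith) (by linarith)
          · nlinarith
      _ = 5 / 2 * Real.exp (-(t / 2)) * (2 / 5) := by ring
      _ ≤ _ := by gcongr; linarith
  have htwo : (2 : ℝ) ≤ 2 ^ (k + 1) := le_self_pow₀ one_le_two (Nat.succ_ne_zero k)
  rw [hD, sub_div, sub_right_comm]
  set x := p * (1 - p)
  have hpx : p ≤ 2 * x := by nlinarith
  calc _ ≤ (8 + k) * p ^ (k + 1) * Real.exp (-(t * x / 2)) + 5 / 2 * Real.exp (-(t / 2)) :=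
        (abs_sub _ _).trans (add_le_add hslow hfast)
    _ ≤ (8 + k) * (2 * x) ^ (k + 1) * Real.exp (-(t * x / 2)) +
        (8 + k) * 2 ^ (k + 1) * Real.exp (-(t / 2)) := by gcongr; nlinarith
    _ = _ := by rw [mul_pow]; ring

theorem abs_dampedDeriv_le_of_le (k : ℕ) (ht : 0 < t) (hx : 0 < x) (hx' : x ≤ 21 / 100) :
    |dampedDeriv k t x| ≤
      ((8 + k) * 2 ^ (k + 1) + 1) * (x ^ k * Real.exp (-(t * x / 2)) + Real.exp (-(t / 2))) := by
  have hheat : |heatDeriv k t x| ≤ x ^ k * Real.exp (-(t * x / 2)) := by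
    rw [heatDeriv, abs_mul, abs_pow, abs_neg, abs_of_pos hx, Real.abs_exp]
    gcongr
    exact half_le_self (by positivity)
  have hpow : x ^ (k + 1) ≤ x ^ k := pow_le_pow_of_le_one hx.le (by linarith) k.le_succ
  calc |dampedDeriv k t x| ≤ |dampedDeriv k t x - heatDeriv k t x| + |heatDeriv k t x| := by
        linarith [abs_sub_abs_le_abs_sub (dampedDeriv k t x) (heatDeriv k t x)]
    _ ≤ (8 + k) * 2 ^ (k + 1) * (x ^ k * Real.exp (-(t * x / 2)) + Real.exp (-(t / 2))) +
        (x ^ k * Real.exp (-(t * x / 2)) + Real.exp (-(t / 2))) := by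
        refine add_le_add ((abs_dampedDeriv_sub_heatDeriv_le k ht hx hx').trans ?_) ?_
        · gcongr
        · linarith [Real.exp_pos (-(t / 2))]
    _ = _ := by ring

end LowFrequency

section HighFrequency

variable {t x : ℝ}

theorem besselSymbol_neg_one (hx : 0 < x) : besselSymbol (-1) x = (Real.sqrt (1 + x))⁻¹ := by
  rw [besselSymbol, Real.sqrt_eq_rpow, ← Real.rpow_neg (by linarith), neg_div]

theorem sinh_le_mul_exp (z : ℝ) : Real.sinh z ≤ z * Real.exp z := by
  have hexp : Real.exp (-z) = Real.exp z * Real.exp (-(2 * z)) := by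
    rw [← Real.exp_add]; congr 1; ring
  rw [Real.sinh_eq, hexp]
  nlinarith [Real.exp_pos z, Real.add_one_le_exp (-(2 * z))]

theorem cosh_le_exp {z : ℝ} (hz : 0 ≤ z) : Real.cosh z ≤ Real.exp z := by
  rw [Real.cosh_eq]
  linarith [Real.exp_le_exp.2 (neg_le_self hz)]

theorem abs_sin_mul_sqrt_le (ht : 0 < t) {y : ℝ} (hy : 0 < y) :
    |Real.sin (t * y)| * Real.sqrt (5 / 4 + y ^ 2) ≤ (1 + 5 / 4 * t) * y := by
  have hsqrt : Real.sqrt (5 / 4 + y ^ 2) ≤ y + 5 / 4 := by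
    rw [Real.sqrt_le_left (by linarith)]; nlinarith
  have hsin : |Real.sin (t * y)| ≤ t * y :=
    Real.abs_sin_le_abs.trans_eq (abs_of_pos (mul_pos ht hy))
  calc |Real.sin (t * y)| * Real.sqrt (5 / 4 + y ^ 2)
      ≤ |Real.sin (t * y)| * (y + 5 / 4) := by gcongr
    _ = |Real.sin (t * y)| * y + 5 / 4 * |Real.sin (t * y)| := by ring
    _ ≤ 1 * y + 5 / 4 * (t * y) := by gcongr; exact Real.abs_sin_le_one _
    _ = _ := by ring

/-- The rate `3/10` is `1/2 - √(1/4 - x)` at `x = 21/100`: above that threshold `𝒟(t, x)` decays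
faster than the weight `e^{-t/4}` of the theorem. -/
theorem abs_dampedSymbol_le_of_lt (ht : 0 < t) (hx : 21 / 100 < x) :
    |dampedSymbol t x| ≤ (1 + 5 / 4 * t) * Real.exp (-(3 / 10 * t)) * besselSymbol (-1) x := by
  have hs : 0 < Real.sqrt (1 + x) := Real.sqrt_pos.2 (by linarith)
  have hexp : Real.exp (-t / 2) ≤ Real.exp (-(3 / 10 * t)) := Real.exp_le_exp.2 (by linarith)
  rw [besselSymbol_neg_one (by linarith), ← div_eq_mul_inv, le_div_iff₀ hs]
  rcases lt_or_ge (1 / 4) x with hx4 | hx4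
  · rw [dampedSymbol, if_neg hx4.not_gt, if_neg hx4.ne']
    set y := Real.sqrt (x - 1 / 4)
    have hy0 : 0 < y := Real.sqrt_pos.2 (by linarith)
    have hy2 : 1 + x = 5 / 4 + y ^ 2 := by rw [Real.sq_sqrt (by linarith)]; ring
    rw [abs_div, abs_mul, Real.abs_exp, abs_of_pos hy0, div_mul_eq_mul_div, div_le_iff₀ hy0, hy2,
      mul_assoc, mul_comm (1 + 5 / 4 * t), mul_assoc]
    exact mul_le_mul hexp (abs_sin_mul_sqrt_le ht hy0) (by positivity) (Real.exp_pos _).le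
  · have hsqrt : Real.sqrt (1 + x) ≤ 5 / 4 := by
      rw [Real.sqrt_le_left (by norm_num)]; linarith
    suffices h : |dampedSymbol t x| ≤ t * Real.exp (-(3 / 10 * t)) by
      calc |dampedSymbol t x| * Real.sqrt (1 + x) ≤ t * Real.exp (-(3 / 10 * t)) * (5 / 4) := by
            gcongr
        _ ≤ _ := by nlinarith [Real.exp_pos (-(3 / 10 * t))]
    rcases hx4.eq_or_lt with heq | hlt
    · rw [dampedSymbol, if_neg heq.not_lt, if_pos heq, abs_of_pos (by positivity)]
      gcongr
    · rw [dampedSymbol, if_pos hlt]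
      set r := Real.sqrt (1 / 4 - x)
      have hr : 0 < r := Real.sqrt_pos.2 (by linarith)
      have hr' : r ≤ 1 / 5 := by rw [Real.sqrt_le_left (by norm_num)]; linarith
      have hsinh : 0 ≤ Real.sinh (t * r) := Real.sinh_nonneg_iff.2 (by positivity)
      rw [abs_of_nonneg (div_nonneg (mul_nonneg (Real.exp_pos _).le hsinh) hr.le), div_le_iff₀ hr]
      calc Real.exp (-t / 2) * Real.sinh (t * r)
          ≤ Real.exp (-t / 2) * (t * r * Real.exp (t * (1 / 5))) := by
            gcongr
            exact (sinh_le_mul_exp _).trans (by gcongr)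
        _ = t * (Real.exp (-t / 2) * Real.exp (t * (1 / 5))) * r := by ring
        _ = t * Real.exp (-(3 / 10 * t)) * r := by
          rw [← Real.exp_add]; congr 3; ring

theorem abs_dampedCosine_le_of_lt (ht : 0 < t) (hx : 21 / 100 < x) :
    |dampedCosine t x| ≤ Real.exp (-(3 / 10 * t)) := by
  have hexp : Real.exp (-(3 / 10 * t)) = Real.exp (-t / 2) * Real.exp (t * (1 / 5)) := by
    rw [← Real.exp_add]; congr 1; ring
  have hone : 1 ≤ Real.exp (t * (1 / 5)) := Real.one_le_exp (by positivity)
  rw [dampedCosine, abs_mul, Real.abs_exp, hexp]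
  gcongr
  split_ifs
  · have hr : Real.sqrt (1 / 4 - x) ≤ 1 / 5 := by
      rw [Real.sqrt_le_left (by norm_num)]; linarith
    rw [abs_of_pos (Real.cosh_pos _)]
    exact (cosh_le_exp (by positivity)).trans (by gcongr)
  · simpa using hone
  · exact (Real.abs_cos_le_one _).trans hone

theorem abs_dampedDeriv_le_of_abs_le {B : ℝ} (hx : 0 < x)
    (h₀ : |dampedDeriv 0 t x| ≤ B * besselSymbol (-1) x) (h₁ : |dampedDeriv 1 t x| ≤ B) (k : ℕ) :
    |dampedDeriv k t x| ≤ 2 ^ k * B * besselSymbol (k - 1) x := by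
  have hB : 0 ≤ B := (abs_nonneg _).trans h₁
  induction k using Nat.twoStepInduction with
  | zero => simpa using h₀
  | one =>
    rw [Nat.cast_one, sub_self, besselSymbol_zero]
    linarith
  | more k hk hk' =>
    have hmono : besselSymbol ((k + 1 : ℕ) - 1) x ≤ besselSymbol ((k + 2 : ℕ) - 1) x :=
      besselSymbol_mono (by push_cast; linarith) hx
    have hmul : x * besselSymbol (k - 1) x ≤ besselSymbol ((k + 2 : ℕ) - 1) x := by
      have htwo : besselSymbol 2 x = 1 + x := by
        rw [besselSymbol, div_self two_ne_zero, Real.rpow_one]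
      have hsplit : ((k + 2 : ℕ) : ℝ) - 1 = 2 + (k - 1) := by push_cast; ring
      rw [hsplit, ← besselSymbol_mul _ _ hx, htwo]
      exact mul_le_mul_of_nonneg_right (by linarith) (besselSymbol_pos _ hx).le
    have hb := besselSymbol_pos ((k : ℝ) - 1) hx
    rw [dampedDeriv]
    calc |-dampedDeriv (k + 1) t x - x * dampedDeriv k t x|
        ≤ |dampedDeriv (k + 1) t x| + x * |dampedDeriv k t x| := by
          refine (abs_sub _ _).trans_eq ?_
          rw [abs_neg, abs_mul, abs_of_pos hx]
      _ ≤ 2 ^ (k + 1) * B * besselSymbol ((k + 1 : ℕ) - 1) x +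
          x * (2 ^ k * B * besselSymbol (k - 1) x) := by gcongr
      _ = 2 ^ (k + 1) * B * besselSymbol ((k + 1 : ℕ) - 1) x +
          2 ^ k * B * (x * besselSymbol (k - 1) x) := by ring
      _ ≤ 2 ^ (k + 1) * B * besselSymbol ((k + 2 : ℕ) - 1) x +
          2 ^ (k + 1) * B * besselSymbol ((k + 2 : ℕ) - 1) x := by gcongr <;> norm_num
      _ = _ := by ring

theorem abs_dampedDeriv_le_of_lt (k : ℕ) (ht : 0 < t) (hx : 21 / 100 < x) :
    |dampedDeriv k t x| ≤ 2 ^ k * (63 * Real.exp (-(7 / 25 * t))) * besselSymbol (k - 1) x := by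
  have hx₀ : 0 < x := by linarith
  have hexp : (1 + 5 / 4 * t) * Real.exp (-(3 / 10 * t)) ≤ 63 * Real.exp (-(7 / 25 * t)) := by
    have hsplit : Real.exp (-(7 / 25 * t)) = Real.exp (1 / 50 * t) * Real.exp (-(3 / 10 * t)) := by
      rw [← Real.exp_add]; congr 1; ring
    rw [hsplit, ← mul_assoc]
    gcongr
    linarith [Real.add_one_le_exp (1 / 50 * t)]
  have hsymbol := abs_dampedSymbol_le_of_lt ht hx
  refine abs_dampedDeriv_le_of_abs_le hx₀
    (hsymbol.trans (mul_le_mul_of_nonneg_right hexp (besselSymbol_pos _ hx₀).le)) ?_ k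
  calc |dampedDeriv 1 t x| ≤ |dampedCosine t x| + |dampedSymbol t x| / 2 := by
        rw [dampedDeriv, ← abs_two, ← abs_div, abs_two]
        exact abs_sub _ _
    _ ≤ Real.exp (-(3 / 10 * t)) + (1 + 5 / 4 * t) * Real.exp (-(3 / 10 * t)) * 1 / 2 := by
        have := besselSymbol_le_one (by norm_num : (-1 : ℝ) ≤ 0) hx₀
        gcongr
        · exact abs_dampedCosine_le_of_lt ht hx
        · exact hsymbol.trans (by gcongr)
    _ ≤ 63 * Real.exp (-(7 / 25 * t)) := by
        have hmono : Real.exp (-(3 / 10 * t)) ≤ Real.exp (-(7 / 25 * t)) :=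
          Real.exp_le_exp.2 (by linarith)
        linarith [Real.exp_pos (-(7 / 25 * t))]

end HighFrequency

section SymbolEstimates

variable {s x : ℝ}

theorem rpow_le_besselSymbol (hs : 0 ≤ s) (hx : 0 < x) : x ^ (s / 2) ≤ besselSymbol s x :=
  Real.rpow_le_rpow hx.le (by linarith) (by linarith)

theorem abs_rpow_mul_le_besselSymbol {γ M z : ℝ} (hs : 0 ≤ s) (hx : 0 < x)
    (hz : |z| ≤ M * besselSymbol γ x) : |x ^ (s / 2) * z| ≤ M * besselSymbol (γ + s) x := by
  rw [abs_mul, abs_of_nonneg (by positivity)]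
  calc x ^ (s / 2) * |z| ≤ besselSymbol s x * (M * besselSymbol γ x) :=
        mul_le_mul (rpow_le_besselSymbol hs hx) hz (abs_nonneg _) (besselSymbol_pos _ hx).le
    _ = M * besselSymbol (γ + s) x := by rw [← besselSymbol_mul γ s hx]; ring

theorem exists_rpow_mul_exp_le {P : ℝ} (hP : 0 ≤ P) :
    ∃ C, 0 < C ∧ ∀ t x : ℝ, 0 < t → 0 < x → x ≤ 1 ∨ 1 ≤ t →
      x ^ P * Real.exp (-(t * x / 2)) ≤
        C * (1 + t) ^ (-P) * Real.exp (-(1 / 8 * (1 + t) * x)) := by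
  obtain ⟨C, hC, h⟩ := exists_rpow_le_mul_exp hP (ε := 1 / 8) (by norm_num)
  refine ⟨C * Real.exp 1, by positivity, fun t x ht hx htx => ?_⟩
  have hpow : x ^ P = (1 + t) ^ (-P) * ((1 + t) * x) ^ P := by
    rw [Real.mul_rpow (by positivity) hx.le, ← mul_assoc, ← Real.rpow_add (by positivity),
      neg_add_cancel, Real.rpow_zero, one_mul]
  have hexp : Real.exp (1 / 8 * ((1 + t) * x)) * Real.exp (-(t * x / 2)) ≤
      Real.exp 1 * Real.exp (-(1 / 8 * (1 + t) * x)) := by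
    rw [← Real.exp_add, ← Real.exp_add]
    refine Real.exp_le_exp.2 ?_
    rcases htx with hx1 | ht1
    · nlinarith [mul_pos ht hx]
    · nlinarith
  calc x ^ P * Real.exp (-(t * x / 2))
      ≤ (1 + t) ^ (-P) * (C * Real.exp (1 / 8 * ((1 + t) * x))) * Real.exp (-(t * x / 2)) := by
        rw [hpow]
        gcongr
        exact h _ (by positivity)
    _ = C * (1 + t) ^ (-P) *
        (Real.exp (1 / 8 * ((1 + t) * x)) * Real.exp (-(t * x / 2))) := by ring
    _ ≤ C * (1 + t) ^ (-P) * (Real.exp 1 * Real.exp (-(1 / 8 * (1 + t) * x))) := by gcongr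
    _ = _ := by ring

theorem exists_exp_neg_half_le {P : ℝ} (hP : 0 ≤ P) :
    ∃ C, 0 < C ∧ ∀ t x : ℝ, 0 < t → x ≤ 1 →
      Real.exp (-(t / 2)) ≤ C * (1 + t) ^ (-P) * Real.exp (-(1 / 8 * (1 + t) * x)) := by
  obtain ⟨C, hC, h⟩ := exists_rpow_mul_exp_le hP
  refine ⟨C, hC, fun t x ht hx1 => ?_⟩
  have hone := h t 1 ht one_pos (.inl le_rfl)
  rw [Real.one_rpow, one_mul, mul_one, mul_one] at hone
  refine hone.trans (mul_le_mul_of_nonneg_left (Real.exp_le_exp.2 ?_) (by positivity))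
  nlinarith

theorem exists_abs_rpow_mul_le {K : ℝ} (hK : 0 < K) (j : ℕ) (hs : 0 ≤ s) :
    ∃ C, 0 < C ∧ ∀ t x z : ℝ, 0 < t → 0 < x → x ≤ 1 →
      |z| ≤ K * (x ^ j * Real.exp (-(t * x / 2)) + Real.exp (-(t / 2))) →
      |x ^ (s / 2) * z| ≤
        C * (1 + t) ^ (-(j + s / 2)) * Real.exp (-(1 / 8 * (1 + t) * x)) := by
  obtain ⟨C, hC, hslow⟩ := exists_rpow_mul_exp_le (P := j + s / 2) (by positivity)
  obtain ⟨C', hC', hfast⟩ := exists_exp_neg_half_le (P := j + s / 2) (by positivity)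
  refine ⟨K * (C + C'), by positivity, fun t x z ht hx hx1 hz => ?_⟩
  rw [abs_mul, abs_of_nonneg (by positivity)]
  have hpow : x ^ ((j : ℝ) + s / 2) = x ^ (s / 2) * x ^ j := by
    rw [add_comm, Real.rpow_add hx, Real.rpow_natCast]
  have hle : x ^ (s / 2) ≤ 1 := Real.rpow_le_one hx.le hx1 (by linarith)
  calc x ^ (s / 2) * |z|
      ≤ x ^ (s / 2) * (K * (x ^ j * Real.exp (-(t * x / 2)) + Real.exp (-(t / 2)))) := by gcongr
    _ = K * (x ^ ((j : ℝ) + s / 2) * Real.exp (-(t * x / 2)) +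
        x ^ (s / 2) * Real.exp (-(t / 2))) := by rw [hpow]; ring
    _ ≤ K * (C * (1 + t) ^ (-(j + s / 2)) * Real.exp (-(1 / 8 * (1 + t) * x)) +
        1 * (C' * (1 + t) ^ (-(j + s / 2)) * Real.exp (-(1 / 8 * (1 + t) * x)))) := by
        refine mul_le_mul_of_nonneg_left (add_le_add (hslow t x ht hx (.inl hx1)) ?_) hK.le
        exact mul_le_mul hle (hfast t x ht hx1) (Real.exp_pos _).le zero_le_one
    _ = _ := by ring

theorem exists_abs_rpow_mul_heatDeriv_le (k : ℕ) (hs : 0 ≤ s) :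
    ∃ C, 0 < C ∧ ∀ t x : ℝ, 1 ≤ t → 21 / 100 < x →
      |x ^ (s / 2) * heatDeriv k t x| ≤
        C * (1 + t) ^ (-(k + s / 2 + 1)) * Real.exp (-(1 / 8 * (1 + t) * x)) := by
  obtain ⟨C, hC, h⟩ := exists_rpow_mul_exp_le (P := k + s / 2 + 1) (by positivity)
  refine ⟨5 * C, by positivity, fun t x ht hx => ?_⟩
  have hx₀ : 0 < x := by linarith
  have hpow : x ^ ((k : ℝ) + s / 2 + 1) = x ^ k * x ^ (s / 2) * x := by
    rw [Real.rpow_add hx₀, Real.rpow_add hx₀, Real.rpow_natCast, Real.rpow_one]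
  calc |x ^ (s / 2) * heatDeriv k t x|
      = x ^ k * x ^ (s / 2) * Real.exp (-(t * x)) := by
        rw [heatDeriv, abs_mul, abs_mul, abs_pow, abs_neg, abs_of_pos hx₀, Real.abs_exp,
          abs_of_nonneg (by positivity)]
        ring
    _ ≤ x ^ k * x ^ (s / 2) * (5 * x) * Real.exp (-(t * x / 2)) := by
        refine mul_le_mul (le_mul_of_one_le_right (by positivity) (by linarith))
          (Real.exp_le_exp.2 (neg_le_neg (half_le_self (by positivity)))) (Real.exp_pos _).le
          (by positivity)
    _ = 5 * (x ^ ((k : ℝ) + s / 2 + 1) * Real.exp (-(t * x / 2))) := by rw [hpow]; ring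
    _ ≤ 5 * (C * (1 + t) ^ (-(k + s / 2 + 1)) * Real.exp (-(1 / 8 * (1 + t) * x))) := by
        exact mul_le_mul_of_nonneg_left (h t x (by linarith) hx₀ (.inr ht)) (by norm_num)
    _ = _ := by ring

theorem exists_abs_dampedDeriv_le (k : ℕ) :
    ∃ M, ∀ t x : ℝ, 0 < t → 0 < x → |dampedDeriv k t x| ≤ M * besselSymbol (k - 1) x := by
  set K : ℝ := (8 + k) * 2 ^ (k + 1) + 1
  refine ⟨4 * K + 2 ^ k * 63, fun t x ht hx => ?_⟩
  have hb := besselSymbol_pos ((k : ℝ) - 1) hx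
  have hK : 0 < K := by positivity
  have hexp {c : ℝ} (hc : 0 ≤ c) : Real.exp (-c) ≤ 1 := Real.exp_le_one_iff.2 (neg_nonpos.2 hc)
  rcases le_or_gt x (21 / 100) with hx1 | hx1
  · have hhalf : 1 / 2 ≤ besselSymbol (k - 1) x := by
      refine le_trans ?_ (besselSymbol_mono (r := -1) (by simp) hx)
      rw [besselSymbol_neg_one hx, one_div]
      refine inv_anti₀ (Real.sqrt_pos.2 (by linarith)) ?_
      rw [Real.sqrt_le_left (by norm_num)]
      linarith
    calc |dampedDeriv k t x|
        ≤ K * (x ^ k * Real.exp (-(t * x / 2)) + Real.exp (-(t / 2))) :=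
          abs_dampedDeriv_le_of_le k ht hx hx1
      _ ≤ K * (1 * 1 + 1) := by
          gcongr
          · exact pow_le_one₀ hx.le (by linarith)
          · exact hexp (by positivity)
          · exact hexp (by positivity)
      _ = 4 * K * (1 / 2) := by ring
      _ ≤ (4 * K + 2 ^ k * 63) * besselSymbol (k - 1) x := by
          gcongr
          exact le_add_of_nonneg_right (by positivity)
  · calc |dampedDeriv k t x|
        ≤ 2 ^ k * (63 * Real.exp (-(7 / 25 * t))) * besselSymbol (k - 1) x :=
          abs_dampedDeriv_le_of_lt k ht hx1
      _ ≤ 2 ^ k * (63 * 1) * besselSymbol (k - 1) x := by gcongr; exact hexp (by positivity)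
      _ ≤ (4 * K + 2 ^ k * 63) * besselSymbol (k - 1) x := by gcongr; linarith

theorem exists_abs_heatDeriv_le (k : ℕ) {δ : ℝ} (hδ : 0 < δ) :
    ∃ M, ∀ t x : ℝ, δ ≤ t → 0 < x → |heatDeriv k t x| ≤ M * besselSymbol (k - 1) x := by
  obtain ⟨M, hM⟩ := exists_abs_exp_mul_besselSymbol_le (k + 1) hδ
  refine ⟨M, fun t x ht hx => ?_⟩
  have hb := besselSymbol_pos ((k : ℝ) - 1) hx
  have hpow : x ^ k ≤ besselSymbol (2 * k) x := by
    have := rpow_le_besselSymbol (s := 2 * k) (by positivity) hx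
    rwa [mul_div_cancel_left₀ _ two_ne_zero, Real.rpow_natCast] at this
  have hsplit : besselSymbol (2 * k) x = besselSymbol (k + 1) x * besselSymbol (k - 1) x := by
    rw [besselSymbol_mul _ _ hx]; congr 1; ring
  calc |heatDeriv k t x| = Real.exp (-(t * x)) * x ^ k := by
        rw [heatDeriv, abs_mul, abs_pow, abs_neg, abs_of_pos hx, Real.abs_exp, mul_comm]
    _ ≤ Real.exp (-(δ * x)) * (besselSymbol (k + 1) x * besselSymbol (k - 1) x) := by
        rw [← hsplit]; gcongr
    _ = Real.exp (-(δ * x)) * besselSymbol (k + 1) x * besselSymbol (k - 1) x := by ring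
    _ ≤ M * besselSymbol (k - 1) x := by
        gcongr
        exact (le_abs_self _).trans (hM x hx)

/-- The symbol of `∂_t^k A^{s/2} 𝒟(t, A)` cut off to frequencies above `21/100`, where it decays
exponentially in time. -/
def highFrequencySymbol (s : ℝ) (k : ℕ) (t : ℝ) : ℝ → ℝ :=
  (Set.Ioi (21 / 100)).indicator fun x => x ^ (s / 2) * dampedDeriv k t x

@[fun_prop]
theorem measurable_highFrequencySymbol (s : ℝ) (k : ℕ) (t : ℝ) :
    Measurable (highFrequencySymbol s k t) :=
  Measurable.indicator (by fun_prop) measurableSet_Ioi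

theorem highFrequencySymbol_of_le {k : ℕ} {t : ℝ} (hx : x ≤ 21 / 100) :
    highFrequencySymbol s k t x = 0 :=
  Set.indicator_of_notMem hx.not_gt _

theorem highFrequencySymbol_of_lt {k : ℕ} {t : ℝ} (hx : 21 / 100 < x) :
    highFrequencySymbol s k t x = x ^ (s / 2) * dampedDeriv k t x :=
  Set.indicator_of_mem (Set.mem_Ioi.2 hx) _

theorem abs_highFrequencySymbol_le (k : ℕ) (hs : 0 ≤ s) {t : ℝ} (ht : 0 < t) (hx : 0 < x) :
    |highFrequencySymbol s k t x| ≤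
      2 ^ k * 63 * Real.exp (-(7 / 25 * t)) * besselSymbol (k + s - 1) x := by
  have hb := besselSymbol_pos (k + s - 1) hx
  rcases le_or_gt x (21 / 100) with hx1 | hx1
  · rw [highFrequencySymbol_of_le hx1, abs_zero]
    positivity
  · rw [highFrequencySymbol_of_lt hx1, mul_assoc (2 ^ k), add_sub_right_comm]
    exact abs_rpow_mul_le_besselSymbol hs hx (abs_dampedDeriv_le_of_lt k ht hx1)

theorem abs_rpow_mul_le_of_le {j k : ℕ} (hjk : j ≤ k) {M z : ℝ} (hs : 0 ≤ s) (hx : 0 < x)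
    (hz : |z| ≤ M * besselSymbol (j - 1) x) :
    |x ^ (s / 2) * z| ≤ M * besselSymbol (k + s - 1) x := by
  have hM : 0 ≤ M := nonneg_of_mul_nonneg_left ((abs_nonneg z).trans hz) (besselSymbol_pos _ hx)
  rw [add_sub_right_comm]
  refine abs_rpow_mul_le_besselSymbol hs hx (hz.trans ?_)
  exact mul_le_mul_of_nonneg_left (besselSymbol_mono (by gcongr) hx) hM

theorem symbolBounds_solutionSymbol (k : ℕ) (hs : 0 ≤ s) :
    SymbolBounds (fun j t x => x ^ (s / 2) * dampedDeriv j t x) (highFrequencySymbol s k) k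
      (Set.Ioi 0) (k + s - 1) (k + s / 2) where
  pos_of_mem _ ht := ht
  measurable j t := by fun_prop
  measurable_hi t := by fun_prop
  hasDerivAt j _ t _ x _ := (hasDerivAt_dampedDeriv j t x).const_mul _
  exists_bound j hj δ hδ := by
    obtain ⟨M, hM⟩ := exists_abs_dampedDeriv_le j
    exact ⟨M, fun t ht x hx => abs_rpow_mul_le_of_le hj hs hx (hM t x (hδ.trans_le ht) hx)⟩
  exists_low_bound := by
    obtain ⟨C, hC, h⟩ := exists_abs_rpow_mul_le (K := (8 + k) * 2 ^ (k + 1) + 1)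
      (by positivity) k hs
    refine ⟨C, 1 / 8, hC, by norm_num, fun t ht x hx => ?_⟩
    have ht₀ : 0 < t := ht
    rcases le_or_gt x (21 / 100) with hx1 | hx1
    · rw [highFrequencySymbol_of_le hx1, sub_zero]
      exact h t x _ ht₀ hx (by linarith) (abs_dampedDeriv_le_of_le k ht₀ hx hx1)
    · rw [highFrequencySymbol_of_lt hx1, sub_self, abs_zero]
      positivity
  exists_high_bound := ⟨2 ^ k * 63, 7 / 25, by positivity, by norm_num,
    fun _ ht _ hx => abs_highFrequencySymbol_le k hs ht hx⟩

theorem symbolBounds_differenceSymbol (k : ℕ) (hs : 0 ≤ s) :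
    SymbolBounds (fun j t x => x ^ (s / 2) * (dampedDeriv j t x - heatDeriv j t x))
      (highFrequencySymbol s k) k (Set.Ici 1) (k + s - 1) (k + s / 2 + 1) where
  pos_of_mem _ ht := one_pos.trans_le ht
  measurable j t := by fun_prop
  measurable_hi t := by fun_prop
  hasDerivAt j _ t _ x _ :=
    ((hasDerivAt_dampedDeriv j t x).sub (hasDerivAt_heatDeriv j t x)).const_mul _
  exists_bound j hj δ hδ := by
    obtain ⟨M, hM⟩ := exists_abs_dampedDeriv_le j
    obtain ⟨M', hM'⟩ := exists_abs_heatDeriv_le j hδ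
    refine ⟨M + M', fun t ht x hx => abs_rpow_mul_le_of_le hj hs hx ?_⟩
    rw [add_mul]
    exact (abs_sub _ _).trans (add_le_add (hM t x (hδ.trans_le ht) hx) (hM' t x ht hx))
  exists_low_bound := by
    obtain ⟨C, hC, h⟩ := exists_abs_rpow_mul_le (K := (8 + k) * 2 ^ (k + 1)) (by positivity)
      (k + 1) hs
    obtain ⟨C', hC', h'⟩ := exists_abs_rpow_mul_heatDeriv_le k hs
    refine ⟨C + C', 1 / 8, by positivity, by norm_num, fun t ht x hx => ?_⟩
    have ht₁ : 1 ≤ t := ht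
    have ht₀ : 0 < t := one_pos.trans_le ht
    rcases le_or_gt x (21 / 100) with hx1 | hx1
    · rw [highFrequencySymbol_of_le hx1, sub_zero]
      refine (h t x _ ht₀ hx (by linarith)
        (abs_dampedDeriv_sub_heatDeriv_le k ht₀ hx hx1)).trans ?_
      rw [Nat.cast_succ, add_right_comm]
      gcongr
      exact le_add_of_nonneg_right hC'.le
    · rw [highFrequencySymbol_of_lt hx1, mul_sub, sub_sub_cancel_left, abs_neg]
      refine (h' t x ht₁ hx1).trans ?_
      gcongr
      exact le_add_of_nonneg_left hC.le
  exists_high_bound := ⟨2 ^ k * 63, 7 / 25, by positivity, by norm_num,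
    fun _ ht _ hx => abs_highFrequencySymbol_le k hs (one_pos.trans_le ht) hx⟩

end SymbolEstimates

end

theorem mainTheorem1_general {X 𝕜 : Type*} [RCLike 𝕜] [MeasurableSpace X] (μ : Measure X)
    (A : Lp 𝕜 2 μ →ₗ.[𝕜] Lp 𝕜 2 μ) (_hA : IsSelfAdjoint A)
    (α : ℝ) (hα : 0 < α) (hdecay : HeatDecay A α)
    (k : ℕ) (q : ℝ) (hq : 1 ≤ q ∧ q ≤ 2) (s : ℝ) (hs : 0 ≤ s)
    (β : ℝ) (hβ : 2 * α + k + s - 1 < β) :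
    (DecayEstimate A (solutionSymbol s) k ⊤ (ENNReal.ofReal q) β
        (2 * α / q + k + s / 2) (Set.Ioi 0) ∧
      DecayEstimate A (solutionSymbol s) k 2 (ENNReal.ofReal q) (k + s - 1)
        (2 * α * (1 / q - 1 / 2) + k + s / 2) (Set.Ioi 0)) ∧
    (DecayEstimate A (differenceSymbol s) k ⊤ (ENNReal.ofReal q) β
        (2 * α / q + k + s / 2 + 1) (Set.Ici 1) ∧
      DecayEstimate A (differenceSymbol s) k 2 (ENNReal.ofReal q) (k + s - 1)
        (2 * α * (1 / q - 1 / 2) + k + s / 2 + 1) (Set.Ici 1)) := by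
  have hS := symbolBounds_solutionSymbol k hs
  have hD := symbolBounds_differenceSymbol k hs
  have hS₀ : (fun t x => x ^ (s / 2) * dampedDeriv 0 t x) = solutionSymbol s := rfl
  have hD₀ : (fun t x => x ^ (s / 2) * (dampedDeriv 0 t x - heatDeriv 0 t x)) =
      differenceSymbol s := by
    ext t x
    rw [differenceSymbol, heatDeriv, pow_zero, one_mul, dampedDeriv]
  have hρ : 0 ≤ (k : ℝ) + s / 2 := by positivity
  have hβ' : 2 * α + (k + s - 1) < β := by linarith
  simp only [add_assoc _ (k : ℝ) (s / 2), add_assoc _ ((k : ℝ) + s / 2) 1, ← hS₀, ← hD₀]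
  exact ⟨⟨hS.decayEstimate_top hρ hα hdecay hq.1 hq.2 hβ',
    hS.decayEstimate_two hρ hα hdecay hq.1 hq.2⟩,
    hD.decayEstimate_top (by positivity) hα hdecay hq.1 hq.2 hβ',
    hD.decayEstimate_two (by positivity) hα hdecay hq.1 hq.2⟩

theorem mainTheorem1 {X 𝕜 : Type*} [RCLike 𝕜] [MeasurableSpace X] (μ : Measure X) [SigmaFinite μ]
    (A : Lp 𝕜 2 μ →ₗ.[𝕜] Lp 𝕜 2 μ) (hA : IsSelfAdjoint A)
    (hA_nonneg : ∀ f : A.domain, 0 ≤ RCLike.re (inner 𝕜 (A f) (f : Lp 𝕜 2 μ)))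
    (α : ℝ) (hα : 0 < α) (hdecay : HeatDecay A α)
    (k : ℕ) (hk : k = 0 ∨ k = 1) (q : ℝ) (hq : 1 ≤ q ∧ q ≤ 2) (s : ℝ) (hs : 0 ≤ s)
    (β : ℝ) (hβ : 2 * α + k + s - 1 < β) :
    -- Matsumura type estimates
    (DecayEstimate A (solutionSymbol s) k ⊤ (ENNReal.ofReal q) β
        (2 * α / q + k + s / 2) (Set.Ioi 0) ∧
      DecayEstimate A (solutionSymbol s) k 2 (ENNReal.ofReal q) (k + s - 1)
        (2 * α * (1 / q - 1 / 2) + k + s / 2) (Set.Ioi 0)) ∧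
    -- asymptotic behaviour
    (DecayEstimate A (differenceSymbol s) k ⊤ (ENNReal.ofReal q) β
        (2 * α / q + k + s / 2 + 1) (Set.Ici 1) ∧
      DecayEstimate A (differenceSymbol s) k 2 (ENNReal.ofReal q) (k + s - 1)
        (2 * α * (1 / q - 1 / 2) + k + s / 2 + 1) (Set.Ici 1)) :=
  mainTheorem1_general μ A hA α hα hdecay k q hq s hs β hβ
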